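/- Let $(\mathcal U,\delta)$ be a differentially closed field of characteristic $0$, and write $z^{(i)}=\delta^i z$. Let $h>1$ and $m>1$ be integers, and let $\beta_{i,j}\in\mathcal U$ ($0\le i\le h$, $1\le j\le m$) be independent differential transcendentals, i.e. the elements $\beta_{i,j}^{(n)}$ ($0\le i\le h$, $1\le j\le m$, $n\ge 0$) are algebraically independent over $\mathbb Q$. Let $F=\mathbb Q\langle\beta_{i,j}\rangle$ be the differential subfield they generate, and let $S\subseteq\mathcal U^m$ be the solution set of the system of $m-1$ linear differential equations $$\sum_{i=0}^h\beta_{i,1}z_1^{(i)}=\sum_{i=0}^h\beta_{i,j}z_j^{(i)},\qquad j=2,\dots,m.$$ (1) $S$ is in definable bijection with $\mathbb A^1(\mathcal U)$ via linear substitutions: there is a map $\sigma:\mathcal U^m\to\mathcal U^m$, a finite composition of elementary substitutions, each replacing one variable $z_k$ by $z_k+c\,z_j^{(n)}$ with $j\ne k$, $n\ge0$, $c\in F$ and fixing the other variables, which maps $S$ bijectively onto $\{(w_1,0,\dots,0):w_1\in\mathcal U\}$; thus $z\mapsto\sigma(z)_1$ is a bijection from $S$ to $\mathcal U$, definable over $F$.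 (2) Consequently $S$ has no proper subspaces of infinite rank. Here, for $W\subseteq\mathcal U^m$, let $I(W)$ be the ideal of differential polynomials over $\mathcal U$ vanishing on $W$; $W$ has infinite rank if the differential coordinate ring $\mathcal U\{x_1,\dots,x_m\}/I(W)$ has infinite transcendence degree over $\mathcal U$. Precisely: (a) no Kolchin closed set $W\subsetneq S$ (with any parameters from $\mathcal U$) has infinite rank; (b) no additive subgroup $H\subsetneq S$ of $\mathcal U^m$ that is Kolchin constructible, i.e. a finite Boolean combination of zero sets of differential polynomials over $\mathcal U$ (equivalently, by quantifier elimination, definable with parameters), has infinite rank; in particular this holds for every such linear subspace over the field of constants. -/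

import Mathlib

/-- The `n`-th derivative `a^(n)` of an element `a` of a differential ring. -/
def iterDeriv {U : Type*} [CommRing U] [Differential U] (n : ℕ) (a : U) : U :=
  (fun x : U => Differential.deriv x)^[n] a

/-- The value at the point `a` of the differential polynomial `f` over `U` in the differential
indeterminates `x_j`, `j : ι`. The variable `(j, n)` stands for the derivative `x_j^(n)`. -/
noncomputable def diffEval {U : Type*} [CommRing U] [Differential U] {ι : Type*} (a : ι → U)
    (f : MvPolynomial (ι × ℕ) U) : U :=
  MvPolynomial.eval (fun p : ι × ℕ => iterDeriv p.2 (a p.1)) f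

/-- `U` is differentially closed: if `f` and `g` are differential polynomials in one
indeterminate, `f` of order exactly `n`, `g` nonzero of order less than `n` (a nonzero element
of `U` has order less than `0`), then some `a` in `U` satisfies `f(a) = 0` and `g(a) ≠ 0`.
Here the variable `i : ℕ` stands for `x^(i)`. -/
def IsDifferentiallyClosed (U : Type*) [Field U] [Differential U] : Prop :=
  ∀ (n : ℕ) (f g : MvPolynomial ℕ U),
    n ∈ f.vars → (∀ i ∈ f.vars, i ≤ n) → g ≠ 0 → (∀ i ∈ g.vars, i < n) →
      ∃ a : U, MvPolynomial.eval (fun i => iterDeriv i a) f = 0 ∧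
        MvPolynomial.eval (fun i => iterDeriv i a) g ≠ 0

/-- The family `b` consists of independent differential transcendentals over `ℚ`: all the
derivatives of all its members are algebraically independent over `ℚ`. -/
def DiffIndependent {U : Type*} [Field U] [CharZero U] [Differential U] {κ : Type*}
    (b : κ → U) : Prop :=
  AlgebraicIndependent ℚ (fun p : κ × ℕ => iterDeriv p.2 (b p.1))

/-- The differential subfield `ℚ⟨b⟩` of `U` generated by the family `b`. -/
def diffFieldGen {U : Type*} [Field U] [Differential U] {κ : Type*} (b : κ → U) : Subfield U :=
  Subfield.closure (Set.range fun p : κ × ℕ => iterDeriv p.2 (b p.1))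

/-- The solution set in `U^m` of the system of the `m - 1` linear differential equations
`∑ i ≤ h, β i 1 * z_1^(i) = ∑ i ≤ h, β i j * z_j^(i)`, `j = 2, …, m`
(with `Fin m` numbering the variables from `0`). -/
def solutionSet {U : Type*} [Field U] [Differential U] {h m : ℕ} (hm : 1 < m)
    (β : Fin (h + 1) → Fin m → U) : Set (Fin m → U) :=
  {z | ∀ j : Fin m, j ≠ ⟨0, by omega⟩ →
    ∑ i : Fin (h + 1), β i ⟨0, by omega⟩ * iterDeriv (i : ℕ) (z ⟨0, by omega⟩) =
      ∑ i : Fin (h + 1), β i j * iterDeriv (i : ℕ) (z j)}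

/-- The changes of variables of `U^m` that are finite compositions of elementary linear
substitutions over `F`, which replace one variable `z_k` by `z_k + c * z_j^(i)`, where `j ≠ k`
and `c ∈ F`, and keep the other variables. Each is a bijection of `U^m` that is definable
over `F`. -/
inductive IsLinearSubstitution {U : Type*} [Field U] [Differential U] (F : Subfield U) {m : ℕ} :
    ((Fin m → U) → (Fin m → U)) → Prop
  | id : IsLinearSubstitution F id
  | step {σ : (Fin m → U) → (Fin m → U)} (hσ : IsLinearSubstitution F σ) {j k : Fin m}
      (hjk : j ≠ k) (c : U) (hc : c ∈ F) (i : ℕ) :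
      IsLinearSubstitution F
        (fun z => Function.update (σ z) k (σ z k + c * iterDeriv i (σ z j)))

/-- Kolchin closed subsets of affine space (differential subvarieties), with parameters in `U`:
the common zero sets of differential polynomials. -/
def IsKolchinClosed {U : Type*} [CommRing U] [Differential U] {ι : Type*}
    (W : Set (ι → U)) : Prop :=
  ∃ T : Set (MvPolynomial (ι × ℕ) U), W = {a | ∀ f ∈ T, diffEval a f = 0}

/-- Kolchin constructible subsets of affine space: the finite Boolean combinations of zero sets
of differential polynomials over `U`. By quantifier elimination these are the sets definable with
parameters in the differentially closed field `U`. -/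
inductive IsKolchinConstructible {U : Type*} [CommRing U] [Differential U] {ι : Type*} :
    Set (ι → U) → Prop
  | zeros (f : MvPolynomial (ι × ℕ) U) : IsKolchinConstructible {a | diffEval a f = 0}
  | compl {W : Set (ι → U)} (hW : IsKolchinConstructible W) : IsKolchinConstructible Wᶜ
  | inter {W W' : Set (ι → U)} (hW : IsKolchinConstructible W)
      (hW' : IsKolchinConstructible W') : IsKolchinConstructible (W ∩ W')

/-- The ideal `I(W)` of the differential polynomials over `U` that vanish on `W`. -/
noncomputable def vanishingDiffIdeal {U : Type*} [CommRing U] [Differential U] {ι : Type*}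
    (W : Set (ι → U)) : Ideal (MvPolynomial (ι × ℕ) U) where
  carrier := {f | ∀ a ∈ W, diffEval a f = 0}
  add_mem' := fun {f g} hf hg a ha => by
    have h1 := hf a ha
    have h2 := hg a ha
    simp only [diffEval] at h1 h2 ⊢
    rw [map_add, h1, h2, add_zero]
  zero_mem' := fun a _ => by simp only [diffEval, map_zero]
  smul_mem' := fun c f hf a ha => by
    have h1 := hf a ha
    simp only [diffEval] at h1 ⊢
    rw [smul_eq_mul, map_mul, h1, mul_zero]

/-- The order of `W`: the transcendence degree over `U` of the differential coordinate ring
`U{x} / I(W)`. If `W` is irreducible with generic point `a` over `U`, this ring is `U{a}`, and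
the order is the transcendence degree of `U⟨a⟩` over `U`; in general it is the largest of the
orders of the irreducible components of the Kolchin closure of `W`. -/
noncomputable def diffOrder {U : Type*} [Field U] [Differential U] {ι : Type*}
    (W : Set (ι → U)) : Cardinal :=
  Algebra.trdeg U (MvPolynomial (ι × ℕ) U ⧸ vanishingDiffIdeal W)

/-- `W` has infinite rank: its order is infinite, that is, the Kolchin polynomial of the generic
point of some component is not constant (equivalently, the Lascar rank of `W` is at least
`ω`). -/
def HasInfiniteRank {U : Type*} [Field U] [Differential U] {ι : Type*}
    (W : Set (ι → U)) : Prop :=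
  Cardinal.aleph0 ≤ diffOrder W

set_option linter.unusedSectionVars false

section

open Polynomial Differential

/-! ### Iterated derivatives -/

section IterDeriv

variable {U : Type*} [CommRing U] [Differential U]

/-! Write `L_j = ∑ β_{i,j} δⁱ`, so that `S` is given by `L_1 z_1 = L_j z_j`. Linear differential
operators over a differential field form a noncommutative Euclidean ring, so elementary
substitutions in two variables turn `P z_a + Q z_b` into `D w_b` with `D` a common left factor of
`P` and `Q` (`pairReduction_diffOp`). The equations are absorbed one at a time: on solutions of the
earlier ones `z_1 = A w_1` for an operator `A`, and the next equation reads `L_1 A w_1 = L_s z_s`.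
If `D` is a nonzero scalar, this equation becomes `w_s = 0`.

That `D` is scalar (`left_factor_trivial`) comes from genericity. If `D` had positive order, its
adjoint would kill some `y ≠ 0`. Then `(L_1 A)* y = 0`, so `y` generates a differential field of
finite transcendence degree over the field `K` of all the other `β`; but `L_s* y = 0` puts the
differential transcendental `β_{0,s}` into that field. Operators are carried together with their
adjoints, so that each factorization can be transposed at once.

The inverse substitution parametrizes `S` additively by differential polynomials in one free
parameter. A proper Kolchin closed subset of `S` forces a nonzero differential equation on the
parameter. A constructible subgroup either does the same, or contains all points whose parameter
avoids such an equation; in the latter case every point is a sum of two of these, so the subgroup is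
all of `S`. An equation on the parameter makes the rank finite: a reduced differential algebra on
one generator satisfying a nonzero equation has finite transcendence degree
(`trdeg_le_of_aeval_eq_zero`). -/

@[simp] lemma iterDeriv_zero (a : U) : iterDeriv 0 a = a := rfl

lemma iterDeriv_succ (n : ℕ) (a : U) : iterDeriv (n + 1) a = (iterDeriv n a)′ :=
  Function.iterate_succ_apply' _ _ _

lemma iterDeriv_add (n : ℕ) (a b : U) : iterDeriv n (a + b) = iterDeriv n a + iterDeriv n b := by
  induction n with
  | zero => rfl
  | succ n ih => simp [iterDeriv_succ, ih]

lemma iterDeriv_neg (n : ℕ) (a : U) : iterDeriv n (-a) = -iterDeriv n a := by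
  induction n with
  | zero => rfl
  | succ n ih => simp [iterDeriv_succ, ih]

lemma iterDeriv_sub (n : ℕ) (a b : U) : iterDeriv n (a - b) = iterDeriv n a - iterDeriv n b := by
  rw [sub_eq_add_neg, iterDeriv_add, iterDeriv_neg, sub_eq_add_neg]

lemma iterDeriv_mem {S : Type*} [SetLike S U] {K : S} (hK : ∀ x ∈ K, x′ ∈ K) (n : ℕ) {a : U}
    (ha : a ∈ K) : iterDeriv n a ∈ K := by
  induction n with
  | zero => exact ha
  | succ n ih => rw [iterDeriv_succ]; exact hK _ ih

end IterDeriv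

/-! ### Linear differential operators and their adjoints -/

section Operators

variable (U : Type*) [CommRing U] [Differential U]

/-- Additive endomorphisms of `U` paired with a formal adjoint. -/
abbrev AdjointPair : Type _ := AddMonoid.End U × (AddMonoid.End U)ᵐᵒᵖ

variable {U}

/-- Multiplication by an element, which is its own adjoint. -/
noncomputable def mulPair : U →+* AdjointPair U :=
  (Module.toAddMonoidEnd U U).prod
    ((Module.toAddMonoidEnd U U).toOpposite fun x y => by
      rw [Commute, SemiconjBy, ← map_mul, ← map_mul, mul_comm])

variable (U) in
/-- The derivation, with adjoint its negative. -/
noncomputable def derivPair : AdjointPair U :=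
  ((Differential.deriv : Derivation ℤ U U).toLinearMap.toAddMonoidHom,
    MulOpposite.op (-(Differential.deriv : Derivation ℤ U U).toLinearMap.toAddMonoidHom))

@[simp] lemma mulPair_fst_apply (c u : U) : (mulPair c).1 u = c * u := rfl
@[simp] lemma mulPair_snd_apply (c u : U) : (mulPair c).2.unop u = c * u := rfl
@[simp] lemma derivPair_snd_apply (u : U) : (derivPair U).2.unop u = -u′ := rfl

lemma AdjointPair.ext {A B : AdjointPair U} (h1 : ∀ u, A.1 u = B.1 u)
    (h2 : ∀ u, A.2.unop u = B.2.unop u) : A = B :=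
  Prod.ext (AddMonoidHom.ext h1) (MulOpposite.unop_injective (AddMonoidHom.ext h2))

@[simp] lemma AdjointPair.mul_fst_apply (A B : AdjointPair U) (u : U) :
    (A * B).1 u = A.1 (B.1 u) := rfl
@[simp] lemma AdjointPair.mul_snd_apply (A B : AdjointPair U) (u : U) :
    (A * B).2.unop u = B.2.unop (A.2.unop u) := rfl
@[simp] lemma AdjointPair.add_fst_apply (A B : AdjointPair U) (u : U) :
    (A + B).1 u = A.1 u + B.1 u := rfl
@[simp] lemma AdjointPair.sub_fst_apply (A B : AdjointPair U) (u : U) :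
    (A - B).1 u = A.1 u - B.1 u := rfl
@[simp] lemma AdjointPair.add_snd_apply (A B : AdjointPair U) (u : U) :
    (A + B).2.unop u = A.2.unop u + B.2.unop u := rfl

lemma derivPair_mul_mulPair (c : U) :
    derivPair U * mulPair c = mulPair c * derivPair U + mulPair c′ := by
  apply AdjointPair.ext <;> intro u
  · change (c * u)′ = c * u′ + c′ * u
    rw [Derivation.leibniz, smul_eq_mul, smul_eq_mul, mul_comm u]
  · change c * -u′ = -(c * u)′ + c′ * u
    rw [Derivation.leibniz, smul_eq_mul, smul_eq_mul]
    ring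

/-- The linear differential operator `∑ pᵢ δⁱ` with its adjoint. -/
noncomputable def diffOp (p : U[X]) : AdjointPair U := p.eval₂ mulPair (derivPair U)

@[simp] lemma diffOp_zero : diffOp (0 : U[X]) = 0 := eval₂_zero _ _
@[simp] lemma diffOp_one : diffOp (1 : U[X]) = 1 := eval₂_one _ _
@[simp] lemma diffOp_C (c : U) : diffOp (C c) = mulPair c := eval₂_C _ _
lemma diffOp_add (p q : U[X]) : diffOp (p + q) = diffOp p + diffOp q := eval₂_add _ _
lemma diffOp_mul_X (p : U[X]) : diffOp (p * X) = diffOp p * derivPair U := eval₂_mul_X _ _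
lemma diffOp_neg (p : U[X]) : diffOp (-p) = -diffOp p :=
  eq_neg_of_add_eq_zero_left (by rw [← diffOp_add, neg_add_cancel, diffOp_zero])
lemma diffOp_sub (p q : U[X]) : diffOp (p - q) = diffOp p - diffOp q := by
  rw [sub_eq_add_neg, diffOp_add, diffOp_neg, sub_eq_add_neg]

lemma diffOp_mul_X_pow (p : U[X]) (n : ℕ) : diffOp (p * X ^ n) = diffOp p * derivPair U ^ n := by
  induction n with
  | zero => simp
  | succ n ih => rw [pow_succ, ← mul_assoc, diffOp_mul_X, ih, pow_succ, mul_assoc]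

lemma derivPair_pow_fst_apply (n : ℕ) (u : U) : (derivPair U ^ n).1 u = iterDeriv n u := by
  induction n with
  | zero => rfl
  | succ n ih => rw [pow_succ', AdjointPair.mul_fst_apply, ih, iterDeriv_succ]; rfl

lemma diffOp_monomial (n : ℕ) (c : U) :
    diffOp (monomial n c) = mulPair c * derivPair U ^ n := by
  rw [← C_mul_X_pow_eq_monomial, diffOp_mul_X_pow, diffOp_C]

lemma diffOp_fst_apply (p : U[X]) (u : U) :
    (diffOp p).1 u = p.sum fun i c => c * iterDeriv i u := by
  induction p using Polynomial.induction_on' with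
  | add p q hp hq =>
    rw [diffOp_add, AdjointPair.add_fst_apply, hp, hq, sum_add_index] <;> simp [add_mul]
  | monomial n a =>
    rw [diffOp_monomial, AdjointPair.mul_fst_apply, derivPair_pow_fst_apply, mulPair_fst_apply,
      sum_monomial_index (f := fun i c => c * iterDeriv i u) _ (zero_mul _)]

lemma derivPair_mul_diffOp (p : U[X]) :
    derivPair U * diffOp p = diffOp (p * X + mapCoeffs p) := by
  induction p using Polynomial.induction_on' with
  | add p q hp hq =>
    rw [diffOp_add, mul_add, hp, hq, ← diffOp_add, map_add]; congr 1; ring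
  | monomial n a =>
    rw [diffOp_add, diffOp_mul_X, mapCoeffs_monomial, diffOp_monomial, diffOp_monomial,
      ← mul_assoc, derivPair_mul_mulPair, add_mul, mul_assoc, mul_assoc, ← pow_succ', ← pow_succ]

/-- A pair that is a linear differential operator with coefficients in `K`. -/
def IsDiffOpOver (K : Subring U) (A : AdjointPair U) : Prop :=
  ∃ p : U[X], (∀ i, p.coeff i ∈ K) ∧ diffOp p = A

variable {K : Subring U}

lemma coeff_mul_X_mem {p : U[X]} (hp : ∀ i, p.coeff i ∈ K) (i : ℕ) : (p * X).coeff i ∈ K := by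
  cases i with
  | zero => simp [K.zero_mem]
  | succ i => simpa using hp i

lemma coeff_C_mem {c : U} (hc : c ∈ K) (i : ℕ) : (C c).coeff i ∈ K := by
  rw [coeff_C]; split_ifs <;> [exact hc; exact K.zero_mem]

lemma coeff_divX_mem {p : U[X]} (hp : ∀ i, p.coeff i ∈ K) (i : ℕ) : (divX p).coeff i ∈ K := by
  rw [coeff_divX]; exact hp _

lemma natDegree_mul_X_add_le {p q : U[X]} {n : ℕ} (hp : p.natDegree ≤ n) (hq : q.natDegree ≤ n) :
    (p * X + q).natDegree ≤ n + 1 :=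
  (natDegree_add_le _ _).trans (max_le (natDegree_mul_le.trans
    (add_le_add hp natDegree_X_le)) (hq.trans n.le_succ))

/-- Right multiplication of a differential operator by a scalar. -/
lemma exists_diffOp_mul_mulPair (hK : ∀ x ∈ K, x′ ∈ K) (n : ℕ) :
    ∀ (p : U[X]) (c : U), (∀ i, p.coeff i ∈ K) → c ∈ K → p.natDegree ≤ n →
      ∃ q : U[X], (∀ i, q.coeff i ∈ K) ∧ diffOp q = diffOp p * mulPair c ∧
        q.natDegree ≤ n ∧ q.coeff n = p.coeff n * c := by
  induction n with
  | zero =>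
    intro p c hp hc hn
    refine ⟨C (p.coeff 0 * c), coeff_C_mem (K.mul_mem (hp 0) hc), ?_, (natDegree_C _).le,
      coeff_C_zero⟩
    rw [eq_C_of_natDegree_le_zero hn, diffOp_C, diffOp_C, map_mul, coeff_C_zero]
  | succ n ih =>
    intro p c hp hc hn
    have hd : (divX p).natDegree ≤ n := by rw [natDegree_divX_eq_natDegree_tsub_one]; omega
    obtain ⟨q₁, h1, e1, d1, l1⟩ := ih (divX p) c (coeff_divX_mem hp) hc hd
    obtain ⟨q₂, h2, e2, d2, l2⟩ := ih (divX p) c′ (coeff_divX_mem hp) (hK c hc) hd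
    -- For `p = p₁ δ + p₀` one has `p c = (p₁ c) δ + p₁ c′ + p₀ c`, and `p₁` has lower order.
    refine ⟨q₁ * X + (q₂ + C (p.coeff 0 * c)), fun i => ?_, ?_, natDegree_mul_X_add_le d1 ?_, ?_⟩
    · rw [coeff_add, coeff_add]
      exact K.add_mem (coeff_mul_X_mem h1 i)
        (K.add_mem (h2 i) (coeff_C_mem (K.mul_mem (hp 0) hc) i))
    · conv_rhs => rw [← divX_mul_X_add p]
      rw [diffOp_add, diffOp_add, diffOp_add, diffOp_mul_X, diffOp_mul_X, e1, e2, add_mul,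
        mul_assoc, mul_assoc, derivPair_mul_mulPair, mul_add, diffOp_C, diffOp_C, map_mul]
      abel
    · exact (natDegree_add_le _ _).trans (max_le d2 ((natDegree_C _).trans_le n.zero_le))
    · rw [coeff_add, coeff_add, coeff_mul_X, l1, coeff_divX, coeff_C_succ,
        coeff_eq_zero_of_natDegree_lt (lt_of_le_of_lt d2 n.lt_succ_self)]
      simp

/-- The adjoint of a differential operator is a differential operator of the same order. -/
lemma exists_diffOp_adjoint (hK : ∀ x ∈ K, x′ ∈ K) (n : ℕ) :
    ∀ p : U[X], (∀ i, p.coeff i ∈ K) → p.natDegree ≤ n →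
      ∃ q : U[X], (∀ i, q.coeff i ∈ K) ∧ (∀ u, (diffOp q).1 u = (diffOp p).2.unop u) ∧
        q.natDegree ≤ n ∧ q.coeff n = (-1) ^ n * p.coeff n := by
  induction n with
  | zero =>
    intro p hp hn
    refine ⟨p, hp, fun u => ?_, hn, by simp⟩
    rw [eq_C_of_natDegree_le_zero hn]; simp
  | succ n ih =>
    intro p hp hn
    have hd : (divX p).natDegree ≤ n := by rw [natDegree_divX_eq_natDegree_tsub_one]; omega
    obtain ⟨q, h1, e1, d1, l1⟩ := ih (divX p) (coeff_divX_mem hp) hd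
    have d2 : (mapCoeffs q).natDegree ≤ n := natDegree_le_iff_coeff_eq_zero.2 fun i hi => by
      rw [coeff_mapCoeffs, coeff_eq_zero_of_natDegree_lt (d1.trans_lt hi), map_zero]
    -- `(p₁ δ + p₀)* = -δ p₁* + p₀`, and `δ q = q δ + q′` with `q′` the coefficientwise derivative.
    -- Each `δ` contributes a sign to the leading coefficient.
    refine ⟨-q * X + (-mapCoeffs q + C (p.coeff 0)), fun i => ?_, fun u => ?_,
      natDegree_mul_X_add_le (by rwa [natDegree_neg]) ?_, ?_⟩
    · rw [coeff_add, coeff_add, coeff_neg]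
      exact K.add_mem (coeff_mul_X_mem (fun i => by rw [coeff_neg]; exact K.neg_mem (h1 i)) i)
        (K.add_mem (K.neg_mem (hK _ (h1 i))) (coeff_C_mem (hp 0) i))
    · have : -q * X + (-mapCoeffs q + C (p.coeff 0)) =
          -(q * X + mapCoeffs q) + C (p.coeff 0) := by ring
      rw [this, diffOp_add, diffOp_neg, ← derivPair_mul_diffOp]
      conv_rhs => rw [← divX_mul_X_add p]
      rw [diffOp_add, diffOp_mul_X, AdjointPair.add_snd_apply, AdjointPair.mul_snd_apply, ← e1]
      rw [AdjointPair.add_fst_apply, diffOp_C]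
      simp only [derivPair_snd_apply, mulPair_fst_apply, mulPair_snd_apply]
      rfl
    · exact (natDegree_add_le _ _).trans (max_le (by rwa [natDegree_neg]) (by simp))
    · rw [coeff_add, coeff_add, coeff_mul_X, coeff_neg, l1, coeff_divX, coeff_C_succ, coeff_neg,
        coeff_eq_zero_of_natDegree_lt (lt_of_le_of_lt d2 n.lt_succ_self)]
      ring

namespace IsDiffOpOver

lemma add {A B : AdjointPair U} (hA : IsDiffOpOver K A) (hB : IsDiffOpOver K B) :
    IsDiffOpOver K (A + B) := by
  obtain ⟨p, hp, rfl⟩ := hA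
  obtain ⟨q, hq, rfl⟩ := hB
  exact ⟨p + q, fun i => by rw [coeff_add]; exact K.add_mem (hp i) (hq i), diffOp_add _ _⟩

lemma sub {A B : AdjointPair U} (hA : IsDiffOpOver K A) (hB : IsDiffOpOver K B) :
    IsDiffOpOver K (A - B) := by
  obtain ⟨p, hp, rfl⟩ := hA
  obtain ⟨q, hq, rfl⟩ := hB
  exact ⟨p - q, fun i => by rw [coeff_sub]; exact K.sub_mem (hp i) (hq i), diffOp_sub _ _⟩

lemma mulPair {c : U} (hc : c ∈ K) : IsDiffOpOver K (mulPair c) :=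
  ⟨C c, coeff_C_mem hc, diffOp_C c⟩

lemma zero : IsDiffOpOver K (0 : AdjointPair U) := ⟨0, fun i => by simp [K.zero_mem], diffOp_zero⟩

lemma one : IsDiffOpOver K (1 : AdjointPair U) := by
  simpa using IsDiffOpOver.mulPair (K := K) K.one_mem

lemma mul_derivPair {A : AdjointPair U} (hA : IsDiffOpOver K A) :
    IsDiffOpOver K (A * derivPair U) := by
  obtain ⟨p, hp, rfl⟩ := hA
  exact ⟨p * X, coeff_mul_X_mem hp, diffOp_mul_X p⟩

lemma mul_mulPair (hK : ∀ x ∈ K, x′ ∈ K) {A : AdjointPair U} (hA : IsDiffOpOver K A) {c : U}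
    (hc : c ∈ K) : IsDiffOpOver K (A * _root_.mulPair c) := by
  obtain ⟨p, hp, rfl⟩ := hA
  obtain ⟨q, hq, e, -⟩ := exists_diffOp_mul_mulPair hK _ p c hp hc le_rfl
  exact ⟨q, hq, e⟩

lemma mul (hK : ∀ x ∈ K, x′ ∈ K) {A B : AdjointPair U} (hA : IsDiffOpOver K A)
    (hB : IsDiffOpOver K B) : IsDiffOpOver K (A * B) := by
  obtain ⟨q, hq, rfl⟩ := hB
  rw [diffOp, eval₂_eq_sum_range, Finset.mul_sum]
  refine Finset.sum_induction _ (IsDiffOpOver K) (fun _ _ => add) zero fun i _ => ?_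
  rw [← mul_assoc]
  induction i with
  | zero => simpa using hA.mul_mulPair hK (hq 0)
  | succ i _ =>
    have : ∀ n, IsDiffOpOver K (A * _root_.mulPair (q.coeff (i + 1)) * derivPair U ^ n) := by
      intro n
      induction n with
      | zero => simpa using hA.mul_mulPair hK (hq _)
      | succ n ih => rw [pow_succ, ← mul_assoc]; exact ih.mul_derivPair
    exact this _

lemma mono {K' : Subring U} (h : K ≤ K') {A : AdjointPair U} (hA : IsDiffOpOver K A) :
    IsDiffOpOver K' A := by
  obtain ⟨p, hp, e⟩ := hA
  exact ⟨p, fun i => h (hp i), e⟩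

end IsDiffOpOver

end Operators

/-! ### Linear substitutions and the Euclidean algorithm -/

section LinearSubstitution

variable {U : Type*} [Field U] [Differential U] {F : Subfield U} {m : ℕ}

namespace IsLinearSubstitution

lemma comp {σ τ : (Fin m → U) → (Fin m → U)} (hσ : IsLinearSubstitution F σ)
    (hτ : IsLinearSubstitution F τ) : IsLinearSubstitution F (σ ∘ τ) := by
  induction hσ with
  | id => exact hτ
  | step _ hjk c hc i ih => exact ih.step hjk c hc i

lemma elementary {j k : Fin m} (hjk : j ≠ k) {c : U} (hc : c ∈ F) (i : ℕ) :
    IsLinearSubstitution F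
      (fun z : Fin m → U => Function.update z k (z k + c * iterDeriv i (z j))) :=
  IsLinearSubstitution.id.step hjk c hc i

lemma mono {F' : Subfield U} (h : F ≤ F') {σ : (Fin m → U) → (Fin m → U)}
    (hσ : IsLinearSubstitution F σ) : IsLinearSubstitution F' σ := by
  induction hσ with
  | id => exact .id
  | step _ hjk c hc i ih => exact ih.step hjk c (h hc) i

lemma exists_inverse {σ : (Fin m → U) → (Fin m → U)} (hσ : IsLinearSubstitution F σ) :
    ∃ τ, IsLinearSubstitution F τ ∧ Function.LeftInverse τ σ ∧ Function.RightInverse τ σ := by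
  induction hσ with
  | id => exact ⟨_, .id, fun _ => rfl, fun _ => rfl⟩
  | @step σ _ j k hjk c hc i ih =>
    obtain ⟨τ, hτ, h1, h2⟩ := ih
    refine ⟨τ ∘ fun z => Function.update z k (z k + -c * iterDeriv i (z j)),
      hτ.comp (elementary hjk (F.neg_mem hc) i), fun z => ?_, fun z => ?_⟩
    · simp [Function.update_of_ne hjk, h1 z]
    · simp only [Function.comp_apply]
      rw [h2]
      simp [Function.update_of_ne hjk]

lemma map_add {σ : (Fin m → U) → (Fin m → U)} (hσ : IsLinearSubstitution F σ)
    (z w : Fin m → U) : σ (z + w) = σ z + σ w := by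
  induction hσ with
  | id => rfl
  | @step σ _ j k hjk c hc i ih =>
    funext l
    by_cases hl : l = k
    · subst hl
      simp [ih, iterDeriv_add]
      ring
    · simp [hl, ih]

end IsLinearSubstitution

/-- A linear substitution in the coordinates `a` and `b` turns `P z_a + Q z_b` into `D w_b`,
where `D` is a common left factor of `P` and `Q`. -/
def PairReduction (F : Subfield U) (a b : Fin m) (P Q : AdjointPair U) : Prop :=
  ∃ σ : (Fin m → U) → (Fin m → U), IsLinearSubstitution F σ ∧
    (∀ z j, j ≠ a → j ≠ b → σ z j = z j) ∧
    (∃ D X Y : AdjointPair U, IsDiffOpOver F.toSubring D ∧ D * X = P ∧ D * Y = Q ∧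
      ∀ z, σ z b = X.1 (z a) + Y.1 (z b)) ∧
    ∃ A B A' B' : AdjointPair U, IsDiffOpOver F.toSubring A ∧ IsDiffOpOver F.toSubring B ∧
      IsDiffOpOver F.toSubring A' ∧ IsDiffOpOver F.toSubring B' ∧
      ∀ z, z a = A.1 (σ z a) + B.1 (σ z b) ∧ z b = A'.1 (σ z a) + B'.1 (σ z b)

namespace PairReduction

variable {a b : Fin m} {P Q : AdjointPair U}

lemma of_left_zero (hQ : IsDiffOpOver F.toSubring Q) : PairReduction F a b 0 Q :=
  ⟨id, .id, fun _ _ _ _ => rfl, ⟨Q, 0, 1, hQ, mul_zero _, mul_one _, fun _ => (zero_add _).symm⟩,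
    1, 0, 0, 1, .one, .zero, .zero, .one, fun _ => ⟨(add_zero _).symm, (zero_add _).symm⟩⟩

lemma diffOp_monomial_apply (n : ℕ) (c u : U) :
    (diffOp (monomial n c)).1 u = c * iterDeriv n u := by
  rw [diffOp_monomial, AdjointPair.mul_fst_apply, derivPair_pow_fst_apply, mulPair_fst_apply]

lemma isDiffOpOver_monomial (n : ℕ) {c : U} (hc : c ∈ F) :
    IsDiffOpOver F.toSubring (diffOp (monomial n c)) :=
  ⟨_, fun i => by rw [coeff_monomial]; split_ifs <;> [exact hc; exact F.zero_mem], rfl⟩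

/-- With `T = c δⁿ`, `P (z_a + T z_b) + (Q - P T) z_b = P z_a + Q z_b`: a right multiple of `P` is
moved from `Q` into the variable `z_a`. -/
lemma of_sub_right (hF : ∀ x ∈ F, x′ ∈ F) (hab : a ≠ b) (n : ℕ) {c : U} (hc : c ∈ F)
    (h : PairReduction F a b P (Q - P * diffOp (monomial n c))) : PairReduction F a b P Q := by
  obtain ⟨σ, hσ, hfix, ⟨D, X, Y, hD, hX, hY, hb⟩, A, B, A', B', hA, hB, hA', hB', hz⟩ := h
  have hT := isDiffOpOver_monomial n hc
  refine ⟨σ ∘ _, hσ.comp (.elementary hab.symm hc n), fun z j ha hb => ?_,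
    ⟨D, X, X * diffOp (monomial n c) + Y, hD, hX, ?_, fun z => ?_⟩,
    A - diffOp (monomial n c) * A', B - diffOp (monomial n c) * B', A', B',
    hA.sub (hT.mul hF hA'), hB.sub (hT.mul hF hB'), hA', hB', fun z => ?_⟩
  · rw [Function.comp_apply, hfix _ _ ha hb, Function.update_of_ne ha]
  · rw [mul_add, ← mul_assoc, hX, hY]; abel
  · rw [Function.comp_apply, hb, Function.update_self, Function.update_of_ne hab.symm,
      AdjointPair.add_fst_apply, AdjointPair.mul_fst_apply, diffOp_monomial_apply, map_add,
      add_assoc]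
  · obtain ⟨h1, h2⟩ := hz (Function.update z a (z a + c * iterDeriv n (z b)))
    rw [Function.update_self] at h1
    rw [Function.update_of_ne hab.symm] at h2
    refine ⟨?_, h2⟩
    rw [AdjointPair.sub_fst_apply, AdjointPair.sub_fst_apply, AdjointPair.mul_fst_apply,
      AdjointPair.mul_fst_apply, Function.comp_apply, sub_add_sub_comm, ← h1, ← map_add, ← h2,
      diffOp_monomial_apply, add_sub_cancel_right]

lemma of_sub_left (hF : ∀ x ∈ F, x′ ∈ F) (hab : a ≠ b) (n : ℕ) {c : U} (hc : c ∈ F)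
    (h : PairReduction F a b (P - Q * diffOp (monomial n c)) Q) : PairReduction F a b P Q := by
  obtain ⟨σ, hσ, hfix, ⟨D, X, Y, hD, hX, hY, hb⟩, A, B, A', B', hA, hB, hA', hB', hz⟩ := h
  have hT := isDiffOpOver_monomial n hc
  refine ⟨σ ∘ _, hσ.comp (.elementary hab hc n), fun z j ha hb => ?_,
    ⟨D, X + Y * diffOp (monomial n c), Y, hD, ?_, hY, fun z => ?_⟩,
    A, B, A' - diffOp (monomial n c) * A, B' - diffOp (monomial n c) * B,
    hA, hB, hA'.sub (hT.mul hF hA), hB'.sub (hT.mul hF hB), fun z => ?_⟩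
  · rw [Function.comp_apply, hfix _ _ ha hb, Function.update_of_ne hb]
  · rw [mul_add, ← mul_assoc, hX, hY]; abel
  · rw [Function.comp_apply, hb, Function.update_self, Function.update_of_ne hab,
      AdjointPair.add_fst_apply, AdjointPair.mul_fst_apply, diffOp_monomial_apply, map_add]
    ring
  · obtain ⟨h1, h2⟩ := hz (Function.update z b (z b + c * iterDeriv n (z a)))
    rw [Function.update_of_ne hab] at h1
    rw [Function.update_self] at h2
    refine ⟨h1, ?_⟩
    rw [AdjointPair.sub_fst_apply, AdjointPair.sub_fst_apply, AdjointPair.mul_fst_apply,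
      AdjointPair.mul_fst_apply, Function.comp_apply, sub_add_sub_comm, ← h2, ← map_add, ← h1,
      diffOp_monomial_apply, add_sub_cancel_right]

end PairReduction

/-- Division step: subtracting a right multiple of `p` lowers the order of `q`. -/
lemma exists_diffOp_sub_mul_monomial (hF : ∀ x ∈ F, x′ ∈ F) {p q : U[X]}
    (hp : ∀ i, p.coeff i ∈ F) (hq : ∀ i, q.coeff i ∈ F) (hp0 : p ≠ 0)
    (hpq : p.natDegree ≤ q.natDegree) :
    ∃ (n : ℕ) (c : U) (r : U[X]), c ∈ F ∧ (∀ i, r.coeff i ∈ F) ∧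
      diffOp r = diffOp q - diffOp p * diffOp (monomial n c) ∧ r.degree < q.natDegree := by
  -- The leading coefficient of `p c δⁿ` is that of `p` times `c`, so this `c` cancels the top term
  -- of `q`.
  set c := q.leadingCoeff / p.leadingCoeff
  have hc : c ∈ F := F.div_mem (hq _) (hp _)
  obtain ⟨r, hr, e, d, l⟩ := exists_diffOp_mul_mulPair (K := F.toSubring) hF p.natDegree p c hp hc
    le_rfl
  set n := q.natDegree - p.natDegree with hn
  refine ⟨n, c, q - r * X ^ n, hc, fun i => ?_, ?_, ?_⟩
  · rw [coeff_sub]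
    refine F.sub_mem (hq i) ?_
    rw [coeff_mul_X_pow']
    split_ifs <;> [exact hr _; exact F.zero_mem]
  · rw [diffOp_sub, diffOp_mul_X_pow, e, diffOp_monomial, mul_assoc]
  · rw [degree_lt_iff_coeff_zero]
    intro i hi
    rw [coeff_sub, coeff_mul_X_pow', if_pos (by omega)]
    rcases hi.eq_or_lt with rfl | hi
    · rw [hn, Nat.sub_sub_self hpq, l, coeff_natDegree, coeff_natDegree,
        mul_div_cancel₀ _ (leadingCoeff_ne_zero.2 hp0), sub_self]
    · rw [coeff_eq_zero_of_natDegree_lt hi, coeff_eq_zero_of_natDegree_lt, sub_zero]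
      omega

/-- The Euclidean algorithm for linear differential operators, as a linear substitution. -/
lemma pairReduction_diffOp (hF : ∀ x ∈ F, x′ ∈ F) {a b : Fin m} (hab : a ≠ b) (N : ℕ) :
    ∀ (s t : ℕ) (p q : U[X]), s + t ≤ N → p.degree < s → q.degree < t → (∀ i, p.coeff i ∈ F) →
      (∀ i, q.coeff i ∈ F) → PairReduction F a b (diffOp p) (diffOp q) := by
  -- The degree bounds are strict, so `s = 0` means `p = 0`. A division step replaces one bound by
  -- the degree of the dividend, which is smaller.
  induction N with
  | zero =>
    intro s t p q hN hs ht hp hq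
    obtain rfl : s = 0 := by omega
    obtain rfl : p = 0 := by simpa using hs
    rw [diffOp_zero]
    exact .of_left_zero ⟨q, hq, rfl⟩
  | succ N ih =>
    intro s t p q hN hs ht hp hq
    by_cases hp0 : p = 0
    · rw [hp0, diffOp_zero]
      exact .of_left_zero ⟨q, hq, rfl⟩
    by_cases hq0 : q = 0
    · subst hq0
      -- Two substitutions bring `(P, 0)` to `(P, P)` and then to `(0, P)`.
      refine .of_sub_right hF hab 0 (F.neg_mem F.one_mem) (.of_sub_left hF hab 0 F.one_mem ?_)
      have h1 : diffOp (monomial 0 (1 : U)) = 1 := by simp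
      have h2 : diffOp (monomial 0 (-1 : U)) = 0 - 1 := by
        rw [← zero_sub (1 : U), map_sub, map_zero, diffOp_sub, diffOp_zero, h1]
      rw [h1, h2, diffOp_zero, mul_sub, mul_zero, mul_one, mul_one, sub_sub_cancel, sub_self]
      exact .of_left_zero ⟨p, hp, rfl⟩
    rw [degree_eq_natDegree hp0, Nat.cast_lt] at hs
    rw [degree_eq_natDegree hq0, Nat.cast_lt] at ht
    rcases le_total p.natDegree q.natDegree with h | h
    · obtain ⟨n, c, r, hc, hr, e, d⟩ := exists_diffOp_sub_mul_monomial hF hp hq hp0 h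
      refine .of_sub_right hF hab n hc (e ▸ ih s q.natDegree p r (by omega) ?_ d hp hr)
      rwa [degree_eq_natDegree hp0, Nat.cast_lt]
    · obtain ⟨n, c, r, hc, hr, e, d⟩ := exists_diffOp_sub_mul_monomial hF hq hp hq0 h
      refine .of_sub_left hF hab n hc (e ▸ ih p.natDegree t r q (by omega) d ?_ hr hq)
      rwa [degree_eq_natDegree hq0, Nat.cast_lt]

end LinearSubstitution

/-! ### Solving equations in a differentially closed field -/

section DifferentiallyClosed

variable {U : Type*} [Field U] [Differential U]

lemma IsDifferentiallyClosed.exists_eval_ne_zero (hU : IsDifferentiallyClosed U)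
    {g : MvPolynomial ℕ U} (hg : g ≠ 0) :
    ∃ a : U, MvPolynomial.eval (fun i => iterDeriv i a) g ≠ 0 := by
  -- The equation `x^(N+1) = 0`, with `N` the largest order in `g`, serves only to make the axiom
  -- applicable.
  obtain ⟨a, -, ha⟩ := hU (g.vars.sup id + 1) (MvPolynomial.X (g.vars.sup id + 1)) g
    (by simp [MvPolynomial.vars_X]) (by simp [MvPolynomial.vars_X]) hg
    (fun i hi => Nat.lt_succ_of_le (Finset.le_sup (f := id) hi))
  exact ⟨a, ha⟩

/-- The differential polynomial `∑ pᵢ x^(i)`. -/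
noncomputable def linearDiffPoly (p : U[X]) : MvPolynomial ℕ U :=
  p.sum fun i c => MvPolynomial.C c * MvPolynomial.X i

lemma eval_linearDiffPoly (p : U[X]) (u : U) :
    MvPolynomial.eval (fun i => iterDeriv i u) (linearDiffPoly p) = (diffOp p).1 u := by
  rw [diffOp_fst_apply, linearDiffPoly, Polynomial.sum, Polynomial.sum, map_sum]
  simp

lemma coeff_linearDiffPoly (p : U[X]) (i : ℕ) :
    (linearDiffPoly p).coeff (Finsupp.single i 1) = p.coeff i := by
  classical
  rw [linearDiffPoly, Polynomial.sum, MvPolynomial.coeff_sum]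
  simp_rw [MvPolynomial.coeff_C_mul, MvPolynomial.coeff_X, Finsupp.single_left_inj one_ne_zero]
  simp +contextual

lemma vars_linearDiffPoly (p : U[X]) {i : ℕ} (hi : i ∈ (linearDiffPoly p).vars) :
    i ≤ p.natDegree := by
  classical
  obtain ⟨j, hj, hij⟩ := Finset.mem_biUnion.1 (MvPolynomial.vars_sum_subset _ _ hi)
  have := MvPolynomial.vars_mul _ _ hij
  rw [MvPolynomial.vars_C, Finset.empty_union, MvPolynomial.vars_X, Finset.mem_singleton] at this
  exact this ▸ le_natDegree_of_mem_supp _ hj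

lemma exists_diffOp_apply_ne_zero (hU : IsDifferentiallyClosed U) {p : U[X]} (hp : p ≠ 0) :
    ∃ u, (diffOp p).1 u ≠ 0 := by
  obtain ⟨u, hu⟩ := hU.exists_eval_ne_zero (g := linearDiffPoly p) fun h => hp <| by
    ext i
    rw [← coeff_linearDiffPoly, h, MvPolynomial.coeff_zero, coeff_zero]
  exact ⟨u, by rwa [eval_linearDiffPoly] at hu⟩

/-- `∑ pᵢ x^(i) - v` has order exactly the degree of `p`, so the axiom allows any side condition of
lower order. -/
lemma exists_diffOp_apply_eq (hU : IsDifferentiallyClosed U) {p : U[X]} (hp : 0 < p.natDegree)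
    (v : U) {g : MvPolynomial ℕ U} (hg : g ≠ 0) (hgv : ∀ i ∈ g.vars, i < p.natDegree) :
    ∃ u, (diffOp p).1 u = v ∧ MvPolynomial.eval (fun i => iterDeriv i u) g ≠ 0 := by
  classical
  have hp0 : p ≠ 0 := by rintro rfl; simp at hp
  have hmem : p.natDegree ∈ (linearDiffPoly p - MvPolynomial.C v).vars := by
    rw [MvPolynomial.mem_vars_iff_mem_support]
    refine ⟨Finsupp.single p.natDegree 1, ?_, by simp⟩
    rw [MvPolynomial.mem_support_iff, MvPolynomial.coeff_sub, coeff_linearDiffPoly,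
      MvPolynomial.coeff_C, if_neg (Finsupp.single_ne_zero.2 one_ne_zero).symm, sub_zero]
    exact leadingCoeff_ne_zero.2 hp0
  have hle : ∀ i ∈ (linearDiffPoly p - MvPolynomial.C v).vars, i ≤ p.natDegree := by
    intro i hi
    have h := MvPolynomial.vars_sub_subset (q := MvPolynomial.C v) (linearDiffPoly p) hi
    rw [MvPolynomial.vars_C, Finset.union_empty] at h
    exact vars_linearDiffPoly p h
  obtain ⟨u, hu, hgu⟩ := hU _ _ g hmem hle hg hgv
  refine ⟨u, ?_, hgu⟩
  rwa [map_sub, eval_linearDiffPoly, MvPolynomial.eval_C, sub_eq_zero] at hu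

lemma diffOp_surjective (hU : IsDifferentiallyClosed U) {p : U[X]} (hp : 0 < p.natDegree)
    (v : U) : ∃ u, (diffOp p).1 u = v := by
  obtain ⟨u, hu, -⟩ := exists_diffOp_apply_eq hU hp v (g := 1) one_ne_zero (by simp)
  exact ⟨u, hu⟩

lemma exists_ne_zero_diffOp_apply_eq_zero (hU : IsDifferentiallyClosed U) {p : U[X]}
    (hp : 0 < p.natDegree) : ∃ u ≠ 0, (diffOp p).1 u = 0 := by
  obtain ⟨u, hu, hg⟩ := exists_diffOp_apply_eq hU hp 0 (g := MvPolynomial.X 0)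
    (MvPolynomial.X_ne_zero _) (by simp [MvPolynomial.vars_X, hp])
  exact ⟨u, by simpa using hg, hu⟩

end DifferentiallyClosed

/-! ### Differential fields generated by part of the transcendentals -/

section DiffField

variable {U : Type*} [Field U] [CharZero U] [Differential U] {κ : Type*}

/-- The differential subfield generated over `ℚ` by the members of the family `b` with index
in `T`. -/
noncomputable def diffFieldOn (b : κ → U) (T : Set κ) : IntermediateField ℚ U :=
  IntermediateField.adjoin ℚ ((fun p : κ × ℕ => iterDeriv p.2 (b p.1)) '' {p | p.1 ∈ T})

lemma mem_diffFieldOn (b : κ → U) {T : Set κ} {k : κ} (hk : k ∈ T) : b k ∈ diffFieldOn b T :=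
  IntermediateField.subset_adjoin _ _ ⟨(k, 0), hk, rfl⟩

lemma diffFieldOn_mono (b : κ → U) {S T : Set κ} (h : S ⊆ T) : diffFieldOn b S ≤ diffFieldOn b T :=
  IntermediateField.adjoin.mono _ _ _ (Set.image_mono fun _ hp => h hp)

lemma diffFieldOn_le_diffFieldGen (b : κ → U) (T : Set κ) :
    (diffFieldOn b T).toSubfield ≤ diffFieldGen b := by
  rw [diffFieldOn, IntermediateField.adjoin_toSubfield, Subfield.closure_le]
  rintro x (⟨q, rfl⟩ | ⟨p, -, rfl⟩)
  · rw [eq_ratCast]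
    exact SubfieldClass.ratCast_mem _ q
  · exact Subfield.subset_closure ⟨p, rfl⟩

/-- Closure of an adjunction under the derivation is checked on generators. -/
lemma deriv_mem_adjoin {k : Type*} [Field k] [Algebra k U] {s : Set U}
    (hk : ∀ c : k, (algebraMap k U c)′ ∈ IntermediateField.adjoin k s)
    (hs : ∀ x ∈ s, x′ ∈ IntermediateField.adjoin k s) :
    ∀ x ∈ IntermediateField.adjoin k s, x′ ∈ IntermediateField.adjoin k s := by
  intro x hx
  induction hx using IntermediateField.adjoin_induction with
  | mem x hx => exact hs x hx
  | algebraMap c => exact hk c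
  | add x y _ _ hx hy => rw [map_add]; exact add_mem hx hy
  | inv x hx hx' =>
    rw [Derivation.leibniz_inv, smul_eq_mul]
    exact mul_mem (neg_mem (pow_mem (inv_mem hx) 2)) hx'
  | mul x y hx hy hx' hy' =>
    rw [Derivation.leibniz, smul_eq_mul, smul_eq_mul]
    exact add_mem (mul_mem hx hy') (mul_mem hy hx')

lemma deriv_mem_diffFieldOn (b : κ → U) (T : Set κ) :
    ∀ x ∈ diffFieldOn b T, x′ ∈ diffFieldOn b T := by
  refine deriv_mem_adjoin (fun c => ?_) ?_
  · have : (algebraMap ℚ U c)′ = 0 := by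
      rw [eq_ratCast, Rat.cast_def, div_eq_mul_inv, Derivation.leibniz, Derivation.leibniz_inv]
      simp
    rw [this]
    exact zero_mem _
  · rintro _ ⟨⟨k, n⟩, hk, rfl⟩
    exact IntermediateField.subset_adjoin _ _ ⟨(k, n + 1), hk, iterDeriv_succ _ _⟩

open scoped IntermediateField.algebraAdjoinAdjoin in
lemma DiffIndependent.algebraicIndependent_diffFieldOn {b : κ → U} (hb : DiffIndependent b)
    {T : Set κ} {k : κ} (hk : k ∉ T) :
    AlgebraicIndependent (diffFieldOn b T) fun n : ℕ => iterDeriv n (b k) := by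
  have h1 := hb.adjoin_of_disjoint (s := {p | p.1 ∈ T}) (t := {p | p.1 = k}) <|
    Set.disjoint_left.2 fun p hp hpk => hk (hpk ▸ hp)
  have h2 := h1.comp (fun n : ℕ => ⟨(k, n), rfl⟩) fun n n' h => by simpa using h
  let S := (fun p : κ × ℕ => iterDeriv p.2 (b p.1)) '' {p | p.1 ∈ T}
  have h3 : AlgebraicIndependent (Algebra.adjoin ℚ S) fun n : ℕ => iterDeriv n (b k) := h2
  exact h3.extendScalars (IntermediateField.adjoin ℚ S)

end DiffField

/-! ### Coprimality from a generic coefficient -/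

section Coprime

variable {U : Type*} [Field U] [CharZero U] [Differential U]

/-- A differential field generated by a solution of a linear equation has finite transcendence
degree. -/
lemma exists_finTrdeg_of_diffOp_apply_eq_zero {K : IntermediateField ℚ U}
    (hK : ∀ x ∈ K, x′ ∈ K) {q : U[X]} (hq : ∀ i, q.coeff i ∈ K) (hq0 : q ≠ 0) {y : U}
    (hy : (diffOp q).1 y = 0) :
    ∃ M : IntermediateField K U, FinTrdeg K M ∧ y ∈ M ∧ ∀ x ∈ M, x′ ∈ M := by
  set n := q.natDegree
  set s : Set U := Set.range fun i : Fin n => iterDeriv i y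
  have hgen : ∀ i < n, iterDeriv i y ∈ IntermediateField.adjoin K s := fun i hi =>
    IntermediateField.subset_adjoin _ _ ⟨⟨i, hi⟩, rfl⟩
  have hKM : ∀ x ∈ K, x ∈ IntermediateField.adjoin K s := fun x hx =>
    IntermediateField.algebraMap_mem _ (⟨x, hx⟩ : K)
  -- The equation can be solved for `y^(n)`, since its leading coefficient is invertible.
  have hn : iterDeriv n y ∈ IntermediateField.adjoin K s := by
    rw [diffOp_fst_apply, sum_over_range _ fun i => zero_mul _, Finset.sum_range_succ,
      add_comm, ← eq_neg_iff_add_eq_zero] at hy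
    have hl : q.coeff n ≠ 0 := leadingCoeff_ne_zero.2 hq0
    rw [eq_div_of_mul_eq hl ((mul_comm _ _).trans hy)]
    refine div_mem (neg_mem (sum_mem fun i hi => ?_)) (hKM _ (hq _))
    exact mul_mem (hKM _ (hq _)) (hgen i (Finset.mem_range.1 hi))
  refine ⟨IntermediateField.adjoin K s, ?_, ?_, deriv_mem_adjoin (fun c => ?_) ?_⟩
  · have : Algebra.EssFiniteType K (IntermediateField.adjoin K s) :=
      IntermediateField.essFiniteType_iff.2
        (IntermediateField.fg_adjoin_of_finite (Set.finite_range _))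
    infer_instance
  · rcases Nat.eq_zero_or_pos n with h | h
    · rw [h] at hn; exact hn
    · exact hgen 0 h
  · exact hKM _ (hK _ c.2)
  · rintro _ ⟨i, rfl⟩
    rw [← iterDeriv_succ]
    rcases Nat.lt_or_ge (i + 1) n with h | h
    · exact hgen _ h
    · rwa [show (i : ℕ) + 1 = n by omega]

/-- If the constant coefficient of `l` is differentially transcendental over a differential field
containing the coefficients of `p` and the other coefficients of `l`, then `p` and `l` have only
trivial common left factors. -/
lemma left_factor_trivial (hU : IsDifferentiallyClosed U) {K : IntermediateField ℚ U}
    (hK : ∀ x ∈ K, x′ ∈ K) {p l : U[X]} (hp : ∀ i, p.coeff i ∈ K) (hp0 : p ≠ 0)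
    (hl : ∀ i, l.coeff (i + 1) ∈ K)
    (hb : AlgebraicIndependent K fun n : ℕ => iterDeriv n (l.coeff 0))
    {D X Y : AdjointPair U} {F : Subring U} (hD : IsDiffOpOver F D) (hX : D * X = diffOp p)
    (hY : D * Y = diffOp l) : ∃ c ≠ 0, D = mulPair c := by
  obtain ⟨d, -, rfl⟩ := hD
  rcases Nat.eq_zero_or_pos d.natDegree with h0 | h0
  · refine ⟨d.coeff 0, fun h => ?_, by rw [← diffOp_C, ← eq_C_of_natDegree_eq_zero h0]⟩
    obtain ⟨u, hu⟩ := exists_diffOp_apply_ne_zero hU hp0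
    rw [eq_C_of_natDegree_eq_zero h0, h, map_zero, diffOp_zero, zero_mul] at hX
    rw [← hX] at hu
    exact hu rfl
  exfalso
  obtain ⟨d', -, hd', hdeg, hlead⟩ := exists_diffOp_adjoint (K := (⊤ : Subring U))
    (fun _ _ => trivial) d.natDegree d (fun _ => trivial) le_rfl
  have hd0 : d ≠ 0 := by rintro rfl; simp at h0
  have hdeg' : d.natDegree ≤ d'.natDegree := le_natDegree_of_ne_zero <| by
    rw [hlead]
    exact mul_ne_zero (pow_ne_zero _ (neg_ne_zero.2 one_ne_zero)) (leadingCoeff_ne_zero.2 hd0)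
  -- The adjoint of `D` has the same positive order, hence a nontrivial kernel.
  obtain ⟨y, hy0, hy⟩ := exists_ne_zero_diffOp_apply_eq_zero hU (h0.trans_le hdeg')
  rw [hd'] at hy
  obtain ⟨q, hq, hqp, -, hqlead⟩ := exists_diffOp_adjoint (K := K.toSubfield.toSubring)
    hK p.natDegree p hp le_rfl
  have hq0 : q ≠ 0 := fun h => mul_ne_zero (pow_ne_zero p.natDegree (neg_ne_zero.2 one_ne_zero))
    (leadingCoeff_ne_zero.2 hp0) (by rw [leadingCoeff, ← hqlead, h, coeff_zero])
  have hqy : (diffOp q).1 y = 0 := by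
    rw [hqp, ← hX, AdjointPair.mul_snd_apply, hy, map_zero]
  obtain ⟨M, hM, hyM, hM'⟩ := exists_finTrdeg_of_diffOp_apply_eq_zero hK hq hq0 hqy
  -- Only `l` without its constant term has coefficients in `K`. The constant term is self-adjoint,
  -- so `l* y = 0` will express it through `y` over `K`.
  obtain ⟨q', hq', hql, -⟩ := exists_diffOp_adjoint (K := K.toSubfield.toSubring)
    hK (divX l * Polynomial.X).natDegree (divX l * Polynomial.X)
    (coeff_mul_X_mem fun i => by rw [coeff_divX]; exact hl i) le_rfl
  have hly : (diffOp q').1 y + l.coeff 0 * y = 0 := by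
    rw [hql, ← mulPair_snd_apply (l.coeff 0) y, ← diffOp_C, ← AdjointPair.add_snd_apply, ← diffOp_add,
      divX_mul_X_add, ← hY, AdjointPair.mul_snd_apply, hy, map_zero]
  have hbM : l.coeff 0 ∈ M := by
    rw [eq_div_of_mul_eq hy0 (eq_neg_of_add_eq_zero_right hly), diffOp_fst_apply]
    refine div_mem (neg_mem (sum_mem fun i _ => ?_)) hyM
    exact mul_mem (M.algebraMap_mem (⟨_, hq' i⟩ : K)) (iterDeriv_mem hM' i hyM)
  -- Infinitely many independent derivatives of `l.coeff 0` cannot lie in `M`, of finite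
  -- transcendence degree over `K`.
  have hfin := finite_of_algebraicIndependent (K := K) (L := M)
    (x := fun n : ℕ => ⟨_, iterDeriv_mem hM' n hbM⟩) (.of_comp M.val hb)
  exact not_finite ℕ

end Coprime

/-! ### Parametrizing the solution set -/

section Parametrization

variable {U : Type*} [Field U] [Differential U] {h m : ℕ}

/-- The `j`-th column of `β` as coefficients of a differential operator. -/
noncomputable def columnPoly (β : Fin (h + 1) → Fin m → U) (j : Fin m) : U[X] :=
  ∑ i : Fin (h + 1), monomial (i : ℕ) (β i j)

lemma columnPoly_apply (β : Fin (h + 1) → Fin m → U) (j : Fin m) (u : U) :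
    (diffOp (columnPoly β j)).1 u = ∑ i : Fin (h + 1), β i j * iterDeriv (i : ℕ) u := by
  have key : ∀ s : Finset (Fin (h + 1)), (diffOp (∑ i ∈ s, monomial (i : ℕ) (β i j))).1 u =
      ∑ i ∈ s, β i j * iterDeriv (i : ℕ) u := by
    classical
    intro s
    induction s using Finset.induction_on with
    | empty => rw [Finset.sum_empty, Finset.sum_empty, diffOp_zero]; rfl
    | insert i s hi ih =>
      rw [Finset.sum_insert hi, Finset.sum_insert hi, diffOp_add, AdjointPair.add_fst_apply, ih,
        PairReduction.diffOp_monomial_apply]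
  exact key _

lemma coeff_columnPoly (β : Fin (h + 1) → Fin m → U) (j : Fin m) (i : Fin (h + 1)) :
    (columnPoly β j).coeff i = β i j := by
  rw [columnPoly, finsetSum_coeff]
  simp [coeff_monomial, Fin.val_inj]

lemma coeff_columnPoly_mem (β : Fin (h + 1) → Fin m → U) (j : Fin m) {S : Type*} [SetLike S U]
    [AddSubmonoidClass S U] {K : S} {n : ℕ} (hn : ∀ i : Fin (h + 1), (i : ℕ) = n → β i j ∈ K) :
    (columnPoly β j).coeff n ∈ K := by
  rw [columnPoly, finsetSum_coeff]
  refine sum_mem fun i _ => ?_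
  rw [coeff_monomial]
  split_ifs with hi
  · exact hn i hi
  · exact zero_mem K

variable [CharZero U]

lemma natDegree_columnPoly_pos (hh : 1 < h) {β : Fin (h + 1) → Fin m → U}
    (hβ : DiffIndependent (fun p : Fin (h + 1) × Fin m => β p.1 p.2)) (j : Fin m) :
    0 < (columnPoly β j).natDegree := by
  refine (zero_lt_one.trans hh).trans_le (le_natDegree_of_ne_zero ?_)
  have := coeff_columnPoly β j (Fin.last h)
  rw [Fin.val_last] at this
  rw [this]
  exact AlgebraicIndependent.ne_zero hβ ((Fin.last h, j), 0)

/-- The first `r` coordinates of a solution are parametrized, after a linear substitution, by the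
first coordinate. -/
lemma exists_linearSubstitution_prefix (hU : IsDifferentiallyClosed U) (hh : 1 < h) (hm : 0 < m)
    {β : Fin (h + 1) → Fin m → U}
    (hβ : DiffIndependent (fun p : Fin (h + 1) × Fin m => β p.1 p.2)) (r : ℕ) (hr : 1 ≤ r) :
    r ≤ m → ∃ σ : (Fin m → U) → (Fin m → U),
      IsLinearSubstitution (diffFieldOn (fun p : Fin (h + 1) × Fin m => β p.1 p.2)
        {p | (p.2 : ℕ) < r}).toSubfield σ ∧
      (∀ (z : Fin m → U) (j : Fin m), r ≤ (j : ℕ) → σ z j = z j) ∧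
      (∀ z, (∀ j : Fin m, j ≠ ⟨0, hm⟩ → (j : ℕ) < r →
          (diffOp (columnPoly β ⟨0, hm⟩)).1 (z ⟨0, hm⟩) = (diffOp (columnPoly β j)).1 (z j)) ↔
        ∀ j : Fin m, j ≠ ⟨0, hm⟩ → (j : ℕ) < r → σ z j = 0) ∧
      ∃ A : AdjointPair U, IsDiffOpOver (diffFieldOn (fun p : Fin (h + 1) × Fin m => β p.1 p.2)
          {p | (p.2 : ℕ) < r}).toSubfield.toSubring A ∧
        ∀ z, (∀ j : Fin m, j ≠ ⟨0, hm⟩ → (j : ℕ) < r → σ z j = 0) →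
          z ⟨0, hm⟩ = A.1 (σ z ⟨0, hm⟩) := by
  set b := fun p : Fin (h + 1) × Fin m => β p.1 p.2 with hbdef
  set o : Fin m := ⟨0, hm⟩ with ho
  induction r, hr using Nat.le_induction with
  | base =>
    intro _
    have hlt : ∀ j : Fin m, j ≠ o → ¬ (j : ℕ) < 1 := fun j hj hj1 => hj <| by
      rw [ho, Fin.ext_iff]; simpa using hj1
    exact ⟨id, .id, fun _ _ _ => rfl, fun z => ⟨fun _ j hj h1 => (hlt j hj h1).elim,
      fun _ j hj h1 => (hlt j hj h1).elim⟩, 1, .one, fun _ _ => rfl⟩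
  | succ r hr ih =>
    intro hrm
    obtain ⟨σ, hσ, hfix, hiff, A, hA, hAz⟩ := ih (by omega)
    set K := diffFieldOn b {p | (p.2 : ℕ) < r}
    set F := diffFieldOn b {p | (p.2 : ℕ) < r + 1}
    set s : Fin m := ⟨r, hrm⟩ with hs
    have hos : o ≠ s := fun e => by rw [ho, hs, Fin.mk.injEq] at e; omega
    have hKF : K ≤ F := diffFieldOn_mono b fun p hp => Nat.lt_succ_of_lt hp
    have hK : ∀ x ∈ K, x′ ∈ K := deriv_mem_diffFieldOn b _
    have hF : ∀ x ∈ F, x′ ∈ F := deriv_mem_diffFieldOn b _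
    -- `p = L_o A` expresses `L_o z_o` through the current parameter `σ z o`.
    obtain ⟨p, hp, hpA⟩ := IsDiffOpOver.mul hK (K := K.toSubfield.toSubring)
      ⟨columnPoly β o, fun n => coeff_columnPoly_mem β o (K := K.toSubfield.toSubring)
        fun i _ => mem_diffFieldOn b (k := (i, o)) hr, rfl⟩ hA
    have hpz : ∀ z, (∀ j : Fin m, j ≠ o → (j : ℕ) < r → σ z j = 0) →
        (diffOp (columnPoly β o)).1 (z o) = (diffOp p).1 (σ z o) := fun z hz => by
      rw [hpA, AdjointPair.mul_fst_apply, ← hAz z hz]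
    have hp0 : p ≠ 0 := by
      rintro rfl
      -- Every `L_j` is onto, so some solution of the system has common value `1`; this rules out `p
      -- = 0`.
      choose z hz using fun j => diffOp_surjective hU (natDegree_columnPoly_pos hh hβ j) 1
      have := hpz z ((hiff z).1 fun j _ _ => by rw [hz, hz])
      rw [hz, diffOp_zero] at this
      exact one_ne_zero this
    obtain ⟨ε, hε, hεfix, ⟨D, X, Y, hD, hDX, hDY, hεs⟩, A', B', _, _, hA', -, -, -, hεz⟩ :=
      pairReduction_diffOp (F := F.toSubfield) hF hos _ _ _ (-p) (columnPoly β s) le_rfl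
        (degree_le_natDegree.trans_lt (WithBot.coe_lt_coe.2 (Nat.lt_succ_self _)))
        (degree_le_natDegree.trans_lt (WithBot.coe_lt_coe.2 (Nat.lt_succ_self _)))
        (fun i => by rw [coeff_neg]; exact neg_mem (hKF (hp i)))
        (fun n => coeff_columnPoly_mem β s
          fun i _ => mem_diffFieldOn b (k := (i, s)) (Nat.lt_succ_self r))
    have hcol : (columnPoly β s).coeff 0 = b (0, s) := coeff_columnPoly β s 0
    -- The base field contains every `β` except `β_{0,s}`: it holds the coefficients of `p` and the
    -- higher coefficients of `L_s`, and `β_{0,s}` is still transcendental over it.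
    obtain ⟨c, hc, rfl⟩ := left_factor_trivial hU (K := diffFieldOn b {(0, s)}ᶜ)
      (deriv_mem_diffFieldOn b _) (p := -p) (l := columnPoly β s)
      (fun i => by
        rw [coeff_neg]
        have hsub : {q : Fin (h + 1) × Fin m | (q.2 : ℕ) < r} ⊆ {(0, s)}ᶜ := by
          rintro q hq rfl
          exact absurd hq (lt_irrefl r)
        exact neg_mem (diffFieldOn_mono b hsub (hp i)))
      (neg_ne_zero.2 hp0)
      (fun n => coeff_columnPoly_mem β s fun i hi => mem_diffFieldOn b (k := (i, s)) fun e => by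
        rw [Set.mem_singleton_iff, Prod.mk.injEq] at e
        rw [e.1] at hi
        simp at hi)
      (by rw [hcol]; exact hβ.algebraicIndependent_diffFieldOn (fun h => h rfl)) hD hDX hDY
    have hkey : ∀ w : Fin m → U,
        (diffOp p).1 (w o) = (diffOp (columnPoly β s)).1 (w s) ↔ ε w s = 0 := by
      intro w
      have : c * ε w s = (diffOp (columnPoly β s)).1 (w s) - (diffOp p).1 (w o) := by
        rw [← mulPair_fst_apply, hεs, map_add, ← AdjointPair.mul_fst_apply,
          ← AdjointPair.mul_fst_apply, hDX, hDY, diffOp_neg, add_comm, sub_eq_add_neg]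
        rfl
      rw [eq_comm, ← sub_eq_zero, ← this, mul_eq_zero, or_iff_right hc]
    have hsucc : ∀ {Q : Fin m → Prop}, (∀ j : Fin m, j ≠ o → (j : ℕ) < r + 1 → Q j) ↔
        (∀ j : Fin m, j ≠ o → (j : ℕ) < r → Q j) ∧ Q s := by
      refine fun {Q} => ⟨fun H => ⟨fun j hj hjr => H j hj (by omega),
        H s hos.symm (Nat.lt_succ_self r)⟩, fun H j hj hjr => ?_⟩
      rcases (Nat.lt_succ_iff.1 hjr).eq_or_lt with e | e
      · obtain rfl : j = s := Fin.ext e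
        exact H.2
      · exact H.1 j hj e
    have hold : ∀ z, (∀ j : Fin m, j ≠ o → (j : ℕ) < r → (ε ∘ σ) z j = 0) ↔
        ∀ j : Fin m, j ≠ o → (j : ℕ) < r → σ z j = 0 := fun z =>
      forall_congr' fun j => forall_congr' fun hj => forall_congr' fun hjr => by
        rw [Function.comp_apply, hεfix _ _ hj fun e => by rw [e] at hjr; exact lt_irrefl _ hjr]
    refine ⟨ε ∘ σ, hε.comp (hσ.mono hKF), fun z j hj => ?_, fun z => ?_, A * A',
      (hA.mono hKF).mul hF hA', fun z hz => ?_⟩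
    · rw [Function.comp_apply, hεfix, hfix z j (by omega)]
      · rintro rfl; simp [ho] at hj
      · rintro rfl; simp [hs] at hj
    · rw [hsucc, hsucc, hiff, hold]
      refine and_congr_right fun hz => ?_
      -- `σ` has not yet touched the coordinate `s`, so `z s` may be read as `σ z s`.
      rw [hpz z hz, ← hfix z s le_rfl, hkey]
      rfl
    · rw [hsucc, hold] at hz
      rw [hAz z hz.1, AdjointPair.mul_fst_apply, (hεz (σ z)).1]
      have : ε (σ z) s = 0 := hz.2
      rw [this, map_zero, add_zero]
      rfl

lemma exists_linearSubstitution (hU : IsDifferentiallyClosed U) (hh : 1 < h) (hm : 1 < m)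
    {β : Fin (h + 1) → Fin m → U}
    (hβ : DiffIndependent (fun p : Fin (h + 1) × Fin m => β p.1 p.2)) :
    ∃ σ : (Fin m → U) → (Fin m → U),
      IsLinearSubstitution (diffFieldGen (fun p : Fin (h + 1) × Fin m => β p.1 p.2)) σ ∧
      ∀ z, z ∈ solutionSet hm β ↔ ∀ j : Fin m, j ≠ ⟨0, zero_lt_one.trans hm⟩ → σ z j = 0 := by
  obtain ⟨σ, hσ, -, hiff, -⟩ :=
    exists_linearSubstitution_prefix hU hh (zero_lt_one.trans hm) hβ m hm.le le_rfl
  refine ⟨σ, hσ.mono (diffFieldOn_le_diffFieldGen _ _), fun z => ?_⟩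
  have := hiff z
  simp only [Fin.is_lt, forall_true_left, columnPoly_apply] at this
  exact this

end Parametrization

/-! ### Transcendence degree of differential algebras on one generator -/

section DifferentialAlgebraTrdeg

variable {k : Type*} [Field k] [CharZero k]

section Domain

variable {B : Type*} [CommRing B] [IsDomain B] [Algebra k B] (d : Derivation ℤ B B)

/-- If a derivation maps a subring `R` into elements algebraic over `R`, then it preserves
algebraicity over `R`. -/
lemma Derivation.isAlgebraic_apply (R : Subalgebra k B)
    (hR : ∀ r ∈ R, IsAlgebraic R (d r)) {b : B} (hb : IsAlgebraic R b) :
    IsAlgebraic R (d b) := by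
  have hchar : CharZero R := charZero_of_injective_algebraMap (algebraMap k R).injective
  have hb' : ∀ p : R[X], IsAlgebraic R (aeval b p) := fun p =>
    (aeval (⟨b, hb⟩ : Subalgebra.algebraicClosure R B) p).2 |> fun h => by
      rwa [← Subalgebra.coe_val, ← aeval_algHom_apply] at h
  -- The difference is `p` with `d` applied to its coefficients, evaluated at `b`.
  have key : ∀ p : R[X], IsAlgebraic R (d (aeval b p) - aeval b (derivative p) * d b) := by
    intro p
    induction p using Polynomial.induction_on' with
    | add p q hp hq =>
      have : d (aeval b (p + q)) - aeval b (derivative (p + q)) * d b =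
          (d (aeval b p) - aeval b (derivative p) * d b) +
            (d (aeval b q) - aeval b (derivative q) * d b) := by
        simp only [map_add]; ring
      rw [this]
      exact hp.add hq
    | monomial n a =>
      have : d (aeval b (monomial n a)) - aeval b (derivative (monomial n a)) * d b =
          d (a : B) * b ^ n := by
        rw [aeval_monomial, derivative_monomial, aeval_monomial, Derivation.leibniz,
          Derivation.leibniz_pow]
        change (a : B) * (n • (b ^ (n - 1) * d b)) + b ^ n * d (a : B) -
          ((a * (n : R) : R) : B) * b ^ (n - 1) * d b = _
        push_cast
        rw [nsmul_eq_mul]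
        ring
      rw [this]
      exact (hR a a.2).mul (hb.pow n)
  obtain ⟨p, ⟨hp0, hp⟩, hmin⟩ : ∃ p : R[X], (p ≠ 0 ∧ aeval b p = 0) ∧
      ∀ q : R[X], q ≠ 0 ∧ aeval b q = 0 → p.natDegree ≤ q.natDegree := by
    obtain ⟨p, hp, hmin⟩ := exists_minimalFor_of_wellFoundedLT
      (fun p : R[X] => p ≠ 0 ∧ aeval b p = 0) natDegree hb
    exact ⟨p, hp, fun q hq => (le_total _ _).elim id fun h => hmin hq h⟩
  -- In characteristic zero a polynomial of least degree annihilating `b` is separable at `b`; so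
  -- `p(b) = 0`, once differentiated, determines `d b` algebraically.
  have hderiv : aeval b (derivative p) ≠ 0 := by
    intro h
    by_cases h0 : derivative p = 0
    · have hc := eq_C_of_natDegree_eq_zero (derivative_eq_zero.1 h0)
      rw [hc, aeval_C] at hp
      rw [(FaithfulSMul.algebraMap_injective R B) (hp.trans (map_zero _).symm), map_zero] at hc
      exact hp0 hc
    · refine absurd (hmin _ ⟨h0, h⟩) (not_le.2 (natDegree_derivative_lt fun hd => h0 ?_))
      rw [eq_C_of_natDegree_eq_zero hd, derivative_C]
  have h1 := key p
  rw [hp, map_zero, zero_sub] at h1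
  have h2 := h1.neg
  rw [neg_neg] at h2
  exact IsAlgebraic.of_mul (mem_nonZeroDivisors_of_ne_zero hderiv) (hb' _) h2

/-- A differential domain generated by one element satisfying a nontrivial differential equation
has transcendence degree bounded by the order of the equation. -/
lemma trdeg_le_of_aeval_eq_zero_of_isDomain (hd : ∀ c, d (algebraMap k B c) ∈ (algebraMap k B).range)
    {x : ℕ → B} (hx : ∀ n, d (x n) = x (n + 1)) (htop : Algebra.adjoin k (Set.range x) = ⊤)
    {g : MvPolynomial ℕ k} (hg0 : g ≠ 0) (hg : MvPolynomial.aeval x g = 0) {N : ℕ}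
    (hN : ∀ i ∈ g.vars, i < N) : Algebra.trdeg k B ≤ N := by
  -- Otherwise `x 0, …, x (N - 1)` would be independent, against `g`. Once `x n` is algebraic over
  -- its predecessors, so are all later derivatives.
  obtain ⟨n, hnN, hn⟩ : ∃ n < N, IsAlgebraic (Algebra.adjoin k (x '' Set.Iio n)) (x n) := by
    by_contra! hcon
    have hind : ∀ n ≤ N, AlgebraicIndepOn k x (Set.Iio n) := by
      intro n
      induction n with
      | zero =>
        intro _
        have : IsEmpty (Set.Iio 0) := ⟨fun i => absurd i.2 (Nat.not_lt_zero _)⟩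
        exact (algebraicIndependent_empty_type_iff (R := k) (A := B)).2
          (algebraMap k B).injective
      | succ n ih =>
        intro hnN
        have : Set.Iio (n + 1) = insert n (Set.Iio n) := by
          ext i; simp [le_iff_eq_or_lt]
        rw [this]
        exact (ih (by omega)).insert (hcon n (by omega))
    have := algebraicIndependent_comp_subtype.1 (hind N le_rfl) g
      ((MvPolynomial.mem_supported).2 fun i hi => hN i hi) hg
    exact hg0 this
  set s : Set B := x '' Set.Iio n
  set R := Algebra.adjoin k s
  have hxR : ∀ i < n, x i ∈ R := fun i hi => Algebra.subset_adjoin ⟨i, hi, rfl⟩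
  have halg : ∀ r ∈ R, IsAlgebraic R r := fun r hr => isAlgebraic_algebraMap (⟨r, hr⟩ : R)
  have hR : ∀ r ∈ R, IsAlgebraic R (d r) := by
    intro r hr
    induction hr using Algebra.adjoin_induction with
    | mem y hy =>
      obtain ⟨i, hi, rfl⟩ := hy
      rw [hx]
      rcases (Nat.succ_le_of_lt hi).eq_or_lt with h | h
      · have h' : x (i + 1) = x n := congrArg x h
        rwa [h']
      · exact halg _ (hxR _ h)
    | algebraMap c =>
      obtain ⟨c', hc'⟩ := hd c
      exact halg _ (hc' ▸ R.algebraMap_mem c')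
    | add y z _ _ hy hz => rw [map_add]; exact hy.add hz
    | mul y z hy hz hy' hz' =>
      rw [Derivation.leibniz, smul_eq_mul, smul_eq_mul]
      exact ((halg y hy).mul hz').add ((halg z hz).mul hy')
  have hxalg : ∀ i, IsAlgebraic R (x i) := by
    intro i
    induction i with
    | zero =>
      rcases Nat.eq_zero_or_pos n with h | h
      · have h' : x 0 = x n := by rw [h]
        rwa [h']
      · exact halg _ (hxR 0 h)
    | succ i ih => rw [← hx]; exact d.isAlgebraic_apply R hR ih
  have : Algebra.IsAlgebraic R B := ⟨fun y => by
    have hy : y ∈ Algebra.adjoin k (Set.range x) := htop ▸ Algebra.mem_top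
    have hle : Algebra.adjoin k (Set.range x) ≤
        (Subalgebra.algebraicClosure R B).restrictScalars k :=
      Algebra.adjoin_le fun _ ⟨i, hi⟩ => hi ▸ hxalg i
    exact hle hy⟩
  have hcard : Cardinal.mk s ≤ N := by
    have := Cardinal.mk_image_le_lift (f := x) (s := Set.Iio n)
    rw [Cardinal.lift_uzero, Cardinal.mk_fintype (Set.Iio n), Fintype.card_Iio, Nat.card_Iio,
      Cardinal.lift_natCast] at this
    exact this.trans (by exact_mod_cast hnN.le)
  exact (Algebra.IsAlgebraic.trdeg_le_cardinalMk k s).trans hcard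

end Domain

/-- In a reduced ring, every derivation preserves the minimal primes. -/
lemma Derivation.apply_mem_of_mem_minimalPrimes {A : Type*} [CommRing A] [IsReduced A]
    (d : Derivation ℤ A A) {p : Ideal A} (hp : p ∈ minimalPrimes A) {a : A} (ha : a ∈ p) :
    d a ∈ p := by
  have hprime : p.IsPrime := hp.isPrime
  obtain ⟨s, hs, has⟩ : ∃ s ∉ p, a * s = 0 := by
    -- A prime avoiding both `a` and the complement of `p` would lie strictly inside `p`.
    have h0 : (0 : A) ∈ Submonoid.powers a ⊔ p.primeCompl := by
      by_contra h0
      obtain ⟨q, hq, -, hdisj⟩ := Ideal.exists_le_prime_disjoint ⊥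
        (Submonoid.powers a ⊔ p.primeCompl) (Set.disjoint_left.2 fun y hy hy' => by
          rw [SetLike.mem_coe, Ideal.mem_bot] at hy
          exact h0 (hy ▸ hy'))
      have hqp : q ≤ p := fun y hy => of_not_not fun hyp =>
        Set.disjoint_left.1 hdisj hy (SetLike.le_def.1 le_sup_right hyp)
      exact Set.disjoint_left.1 hdisj (hp.2 ⟨hq, bot_le⟩ hqp ha)
        (SetLike.le_def.1 le_sup_left (Submonoid.mem_powers a))
    obtain ⟨_, ⟨n, rfl⟩, s, hs, h⟩ := Submonoid.mem_sup.1 h0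
    refine ⟨s, hs, eq_zero_of_pow_eq_zero (n := n + 1) ?_⟩
    change a ^ n * s = 0 at h
    rw [show (a * s) ^ (n + 1) = a ^ n * s * (a * s ^ n) by ring, h, zero_mul]
  have h := congrArg d has
  rw [Derivation.leibniz, map_zero, smul_eq_mul, smul_eq_mul] at h
  -- Multiply `a · d s + s · d a = 0` by `s`; the first term dies since `a s = 0`.
  have h2 : d a * (s * s) = 0 := by
    linear_combination s * h - d s * has
  have := h2 ▸ p.zero_mem
  exact ((hprime.mem_or_mem this).resolve_right fun h3 =>
    (hprime.mem_or_mem h3).elim hs hs)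

/-- A reduced differential algebra generated by one element satisfying a nontrivial differential
equation has finite transcendence degree. -/
lemma trdeg_le_of_aeval_eq_zero {A : Type*} [CommRing A] [IsReduced A] [Algebra k A]
    (d : Derivation ℤ A A) (hd : ∀ c, d (algebraMap k A c) ∈ (algebraMap k A).range)
    {x : ℕ → A} (hx : ∀ n, d (x n) = x (n + 1)) (htop : Algebra.adjoin k (Set.range x) = ⊤)
    {g : MvPolynomial ℕ k} (hg0 : g ≠ 0) (hg : MvPolynomial.aeval x g = 0) {N : ℕ}
    (hN : ∀ i ∈ g.vars, i < N) : Algebra.trdeg k A ≤ N := by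
  refine ciSup_le' fun ⟨s, hs⟩ => ?_
  set φ : MvPolynomial s k →ₐ[k] A := MvPolynomial.aeval ((↑) : s → A)
  have hφ : Function.Injective φ := hs
  -- A prime avoiding all nonzero polynomials in the independent set `s` contains a minimal prime
  -- `p` that avoids them too. So `s` stays independent in the differential domain `A ⧸ p`.
  have hdisj : Disjoint ((⊥ : Ideal A) : Set A)
      ((nonZeroDivisors (MvPolynomial s k)).map φ : Set A) := by
    rw [Set.disjoint_left]
    rintro _ h0 ⟨f, hf, rfl⟩
    exact nonZeroDivisors.ne_zero hf (hφ ((Ideal.mem_bot.1 h0).trans (map_zero φ).symm))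
  obtain ⟨J, hJ, -, hJdisj⟩ := Ideal.exists_le_prime_disjoint _ _ hdisj
  obtain ⟨p, hp, hpJ⟩ := Ideal.exists_minimalPrimes_le (I := (⊥ : Ideal A)) (J := J) bot_le
  have hprime : p.IsPrime := hp.isPrime
  obtain ⟨D, hD⟩ : ∃ D : Derivation ℤ (A ⧸ p) (A ⧸ p), ∀ a,
      D (Ideal.Quotient.mkₐ k p a) = Ideal.Quotient.mkₐ k p (d a) :=
    ⟨_, Derivation.liftOfSurjective_apply (f := (Ideal.Quotient.mk p).toIntAlgHom)
      Ideal.Quotient.mk_surjective fun a ha => Ideal.Quotient.eq_zero_iff_mem.2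
        (d.apply_mem_of_mem_minimalPrimes hp (Ideal.Quotient.eq_zero_iff_mem.1 ha))⟩
  have hind : AlgebraicIndependent k fun a : s => Ideal.Quotient.mkₐ k p a := by
    rw [algebraicIndependent_iff]
    intro f hf
    by_contra hf0
    have h1 : MvPolynomial.aeval (fun a : s => Ideal.Quotient.mkₐ k p a) f =
        Ideal.Quotient.mkₐ k p (φ f) := by
      rw [MvPolynomial.comp_aeval_apply]
    rw [h1] at hf
    exact Set.disjoint_left.1 hJdisj (hpJ (Ideal.Quotient.eq_zero_iff_mem.1 hf))
      ⟨f, mem_nonZeroDivisors_of_ne_zero hf0, rfl⟩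
  refine hind.cardinalMk_le_trdeg.trans (trdeg_le_of_aeval_eq_zero_of_isDomain D
    (x := fun n => Ideal.Quotient.mkₐ k p (x n))
    (fun c => ?_) (fun n => ?_) ?_ hg0 ?_ hN)
  · obtain ⟨c', hc'⟩ := hd c
    refine ⟨c', ?_⟩
    exact (congrArg (Ideal.Quotient.mkₐ k p) hc').trans (hD (algebraMap k A c)).symm
  · exact (hD (x n)).trans (congrArg _ (hx n))
  · have := congrArg (Subalgebra.map (Ideal.Quotient.mkₐ k p)) htop
    rw [AlgHom.map_adjoin, ← Set.range_comp, Algebra.map_top,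
      (AlgHom.range_eq_top _).2 (Ideal.Quotient.mkₐ_surjective k p)] at this
    exact this
  · have := congrArg (Ideal.Quotient.mkₐ k p) hg
    rw [map_zero, MvPolynomial.comp_aeval_apply] at this
    exact this

end DifferentialAlgebraTrdeg

end

section

open Differential

lemma MvPolynomial.eval_bind₁ {R σ τ : Type*} [CommSemiring R] (x : τ → R)
    (f : σ → MvPolynomial τ R) (p : MvPolynomial σ R) :
    eval x (bind₁ f p) = eval (fun i => eval x (f i)) p :=
  eval₂Hom_bind₁ _ _ _ _

/-! ### Differential polynomials on a parametrized line -/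

section DiffPolyFun

variable {U : Type*} [Field U] [Differential U]

/-- Functions given by a differential polynomial in one indeterminate. -/
def IsDiffPolyFun (f : U → U) : Prop :=
  ∃ q : MvPolynomial ℕ U, ∀ w, f w = MvPolynomial.eval (fun i => iterDeriv i w) q

namespace IsDiffPolyFun

lemma id : IsDiffPolyFun (fun w : U => w) := ⟨MvPolynomial.X 0, fun w => by simp⟩

lemma zero : IsDiffPolyFun (fun _ : U => 0) := ⟨0, fun w => by simp⟩

lemma add {f g : U → U} (hf : IsDiffPolyFun f) (hg : IsDiffPolyFun g) :
    IsDiffPolyFun fun w => f w + g w := by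
  obtain ⟨p, hp⟩ := hf
  obtain ⟨q, hq⟩ := hg
  exact ⟨p + q, fun w => by simp only [map_add, hp, hq]⟩

lemma const_mul (c : U) {f : U → U} (hf : IsDiffPolyFun f) : IsDiffPolyFun fun w => c * f w := by
  obtain ⟨p, hp⟩ := hf
  exact ⟨MvPolynomial.C c * p, fun w => by simp only [map_mul, hp, MvPolynomial.eval_C]⟩

lemma deriv {f : U → U} (hf : IsDiffPolyFun f) : IsDiffPolyFun fun w => (f w)′ := by
  obtain ⟨p, hp⟩ := hf
  simp only [hp]
  clear hp
  induction p using MvPolynomial.induction_on with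
  | C a => exact ⟨MvPolynomial.C a′, fun w => by simp⟩
  | add p q hp hq =>
    obtain ⟨p', hp'⟩ := hp
    obtain ⟨q', hq'⟩ := hq
    exact ⟨p' + q', fun w => by simp only [map_add, hp', hq']⟩
  | mul_X p i hp =>
    obtain ⟨p', hp'⟩ := hp
    refine ⟨p * MvPolynomial.X (i + 1) + MvPolynomial.X i * p', fun w => ?_⟩
    simp only [map_add, map_mul, MvPolynomial.eval_X, Derivation.leibniz, smul_eq_mul, hp',
      iterDeriv_succ]

lemma iterDeriv_comp {f : U → U} (hf : IsDiffPolyFun f) (n : ℕ) :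
    IsDiffPolyFun fun w => iterDeriv n (f w) := by
  induction n with
  | zero => exact hf
  | succ n ih => simp only [iterDeriv_succ]; exact ih.deriv

/-- Pulls equations on the ambient space back to equations on the parameter. -/
lemma diffEval_comp {ι : Type*} {τ : U → ι → U} (hτ : ∀ j, IsDiffPolyFun fun w => τ w j)
    (f : MvPolynomial (ι × ℕ) U) : IsDiffPolyFun fun w => diffEval (τ w) f := by
  choose q hq using fun p : ι × ℕ => (hτ p.1).iterDeriv_comp p.2
  refine ⟨MvPolynomial.bind₁ q f, fun w => ?_⟩
  rw [MvPolynomial.eval_bind₁]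
  simp only [diffEval, ← hq]

end IsDiffPolyFun

lemma IsLinearSubstitution.isDiffPolyFun {F : Subfield U} {m : ℕ}
    {σ : (Fin m → U) → (Fin m → U)} (hσ : IsLinearSubstitution F σ) {τ : U → Fin m → U}
    (hτ : ∀ j, IsDiffPolyFun fun w => τ w j) (j : Fin m) : IsDiffPolyFun fun w => σ (τ w) j := by
  induction hσ generalizing j with
  | id => exact hτ j
  | @step σ _ a k _ c _ i ih =>
    by_cases hj : j = k
    · subst hj
      simp only [Function.update_self]
      exact (ih j).add (((ih a).iterDeriv_comp i).const_mul c)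
    · simp only [Function.update_of_ne hj]
      exact ih j

/-- A constructible subset of a parametrized line is contained in the zero set of a nonzero
differential polynomial, or its complement is. -/
lemma IsKolchinConstructible.exists_ne_zero {ι : Type*} {τ : U → ι → U}
    (hτ : ∀ j, IsDiffPolyFun fun w => τ w j) {W : Set (ι → U)} (hW : IsKolchinConstructible W) :
    (∃ g : MvPolynomial ℕ U, g ≠ 0 ∧
      ∀ w, τ w ∈ W → MvPolynomial.eval (fun i => iterDeriv i w) g = 0) ∨
    ∃ g : MvPolynomial ℕ U, g ≠ 0 ∧
      ∀ w, τ w ∉ W → MvPolynomial.eval (fun i => iterDeriv i w) g = 0 := by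
  induction hW with
  | zeros f =>
    obtain ⟨q, hq⟩ := IsDiffPolyFun.diffEval_comp hτ f
    by_cases h : q = 0
    · exact .inr ⟨1, one_ne_zero, fun w hw => (hw (by
        exact (hq w).trans (by rw [h, map_zero]))).elim⟩
    · exact .inl ⟨q, h, fun w hw => (hq w).symm.trans hw⟩
  | compl _ ih =>
    rcases ih with ⟨g, hg, h⟩ | ⟨g, hg, h⟩
    · exact .inr ⟨g, hg, fun w hw => h w (not_not.1 hw)⟩
    · exact .inl ⟨g, hg, fun w hw => h w hw⟩
  | inter _ _ ih ih' =>
    rcases ih with ⟨g, hg, h⟩ | ⟨g, hg, h⟩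
    · exact .inl ⟨g, hg, fun w hw => h w hw.1⟩
    rcases ih' with ⟨g', hg', h'⟩ | ⟨g', hg', h'⟩
    · exact .inl ⟨g', hg', fun w hw => h' w hw.2⟩
    -- Two nonempty open conditions on the line are compatible, because the differential polynomial
    -- ring is a domain.
    · refine .inr ⟨g * g', mul_ne_zero hg hg', fun w hw => ?_⟩
      rw [map_mul, mul_eq_zero]
      exact (not_and_or.1 hw).imp (h w) (h' w)

/-- An additive subgroup containing a Kolchin open subset of a parametrized line contains the
line. -/
lemma AddSubgroup.mem_of_forall_notMem_eval_eq_zero (hU : IsDifferentiallyClosed U) {ι : Type*}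
    {τ : U → ι → U} (hadd : ∀ u v, τ (u + v) = τ u + τ v) (H : AddSubgroup (ι → U))
    {g : MvPolynomial ℕ U} (hg : g ≠ 0)
    (h : ∀ w, τ w ∉ H → MvPolynomial.eval (fun i => iterDeriv i w) g = 0) (u : U) : τ u ∈ H := by
  -- `g'(w) = g(u - w)`. Where `g g'` does not vanish, both `τ w` and `τ (u - w)` lie in `H`, and
  -- they sum to `τ u`.
  set g' : MvPolynomial ℕ U := MvPolynomial.bind₁
    (fun i => MvPolynomial.C (iterDeriv i u) - MvPolynomial.X i) g
  have hg'_eval : ∀ w, MvPolynomial.eval (fun i => iterDeriv i w) g' =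
      MvPolynomial.eval (fun i => iterDeriv i (u - w)) g := fun w => by
    simp only [g', MvPolynomial.eval_bind₁, map_sub, MvPolynomial.eval_C, MvPolynomial.eval_X,
      iterDeriv_sub]
  have hg' : g' ≠ 0 := by
    obtain ⟨a, ha⟩ := hU.exists_eval_ne_zero hg
    intro h0
    have := hg'_eval (u - a)
    rw [h0, map_zero, sub_sub_cancel] at this
    exact ha this.symm
  obtain ⟨w, hw⟩ := hU.exists_eval_ne_zero (mul_ne_zero hg hg')
  rw [map_mul, hg'_eval] at hw
  have h1 : τ w ∈ H := of_not_not fun hc => left_ne_zero_of_mul hw (h w hc)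
  have h2 : τ (u - w) ∈ H := of_not_not fun hc => right_ne_zero_of_mul hw (h _ hc)
  have := H.add_mem h1 h2
  rwa [← hadd, add_sub_cancel] at this

end DiffPolyFun

/-! ### Finite rank of subsets with a constrained parameter -/

section FiniteRank

variable {U : Type*} [Field U] [CharZero U] [Differential U]

lemma MvPolynomial.aeval_pi_apply {R X σ : Type*} [CommSemiring R] (ξ : σ → X → R)
    (q : MvPolynomial σ R) (w : X) :
    MvPolynomial.aeval ξ q w = MvPolynomial.eval (fun n => ξ n w) q := by
  have := MvPolynomial.comp_aeval_apply (f := ξ) (Pi.evalAlgHom R (fun _ : X => R) w) q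
  rw [MvPolynomial.aeval_eq_eval] at this
  exact this

/-- The functions on a set of a line given by differential polynomials form an algebra of finite
transcendence degree, if one nonzero differential polynomial vanishes on the set. -/
lemma trdeg_adjoin_iterDeriv_lt (W : Set U) {g : MvPolynomial ℕ U} (hg0 : g ≠ 0)
    (hg : ∀ w ∈ W, MvPolynomial.eval (fun i => iterDeriv i w) g = 0) :
    Algebra.trdeg U (Algebra.adjoin U
      (Set.range fun (n : ℕ) (w : W) => iterDeriv n (w : U))) < Cardinal.aleph0 := by
  set ξ : ℕ → W → U := fun n w => iterDeriv n (w : U)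
  set A := Algebra.adjoin U (Set.range ξ)
  -- The pointwise derivation on functions `W → U`, restricted below to `A`. As a ring of functions
  -- into a field `A` is reduced, though it need not be a domain.
  let D : Derivation ℤ (W → U) (W → U) := Derivation.mk'
    (AddMonoidHom.toIntLinearMap
      { toFun := fun f w => Differential.deriv (f w)
        map_zero' := funext fun w => map_zero _
        map_add' := fun f f' => funext fun w => map_add _ _ _ })
    fun f f' => funext fun w => Derivation.leibniz _ _ _
  have hDξ : ∀ n, D (ξ n) = ξ (n + 1) := fun n => funext fun w => (iterDeriv_succ _ _).symm
  have hDc : ∀ c : U, D (algebraMap U (W → U) c) = algebraMap U (W → U) c′ := fun c => rfl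
  have hDA : ∀ f ∈ A, D f ∈ A := by
    intro f hf
    induction hf using Algebra.adjoin_induction with
    | mem f hf =>
      obtain ⟨n, rfl⟩ := hf
      exact hDξ n ▸ Algebra.subset_adjoin ⟨n + 1, rfl⟩
    | algebraMap c => rw [hDc]; exact A.algebraMap_mem _
    | add f f' _ _ h h' => rw [map_add]; exact add_mem h h'
    | mul f f' hf hf' h h' =>
      rw [Derivation.leibniz]
      exact add_mem (mul_mem hf h') (mul_mem hf' h)
  let d : Derivation ℤ A A := Derivation.mk'
    (AddMonoidHom.toIntLinearMap
      { toFun := fun f => ⟨D f, hDA f f.2⟩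
        map_zero' := Subtype.ext (map_zero D)
        map_add' := fun f f' => Subtype.ext (map_add D _ _) })
    fun f f' => Subtype.ext (D.leibniz _ _)
  have hred : IsReduced A := isReduced_of_injective A.val Subtype.val_injective
  set x : ℕ → A := fun n => ⟨ξ n, Algebra.subset_adjoin ⟨n, rfl⟩⟩
  have htop : Algebra.adjoin U (Set.range x) = ⊤ := by
    rw [← Algebra.adjoin_adjoin_coe_preimage]
    congr 1
    ext f
    constructor
    · rintro ⟨n, rfl⟩; exact ⟨n, rfl⟩
    · rintro ⟨n, hn⟩; exact ⟨n, Subtype.ext hn⟩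
  refine (trdeg_le_of_aeval_eq_zero d (fun c => ⟨c′, rfl⟩) (x := x)
    (fun n => Subtype.ext (hDξ n)) htop hg0 ?_
    (fun i hi => Nat.lt_succ_of_le (Finset.le_sup (f := id) hi))).trans_lt
    (Cardinal.natCast_lt_aleph0)
  apply Subtype.val_injective
  have h1 : A.val (MvPolynomial.aeval x g) = MvPolynomial.aeval ξ g :=
    MvPolynomial.comp_aeval_apply _ A.val g
  refine h1.trans (funext fun w => ?_)
  rw [MvPolynomial.aeval_pi_apply]
  exact hg w w.2

/-- A subset of a parametrized line has finite rank if its parameters satisfy a nontrivial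
differential equation. -/
lemma not_hasInfiniteRank {m : ℕ} {τ : U → Fin m → U} (hτ : ∀ j, IsDiffPolyFun fun w => τ w j)
    {W : Set (Fin m → U)} (hW : W ⊆ Set.range τ) {g : MvPolynomial ℕ U} (hg0 : g ≠ 0)
    (hg : ∀ w, τ w ∈ W → MvPolynomial.eval (fun i => iterDeriv i w) g = 0) :
    ¬ HasInfiniteRank W := by
  rw [HasInfiniteRank, not_le]
  refine lt_of_le_of_lt ?_ (trdeg_adjoin_iterDeriv_lt {w | τ w ∈ W} hg0 hg)
  set ξ : ℕ → {w | τ w ∈ W} → U := fun n w => iterDeriv n (w : U)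
  set A := Algebra.adjoin U (Set.range ξ)
  have hmem : ∀ p : Fin m × ℕ, (fun w : {w | τ w ∈ W} => iterDeriv p.2 (τ w p.1)) ∈ A := by
    intro p
    obtain ⟨q, hq⟩ := (hτ p.1).iterDeriv_comp p.2
    have : (fun w : {w | τ w ∈ W} => iterDeriv p.2 (τ w p.1)) = MvPolynomial.aeval ξ q :=
      funext fun w => by
        rw [MvPolynomial.aeval_pi_apply]
        exact hq w
    rw [this]
    change _ ∈ Algebra.adjoin U (Set.range ξ)
    rw [Algebra.adjoin_range_eq_range_aeval]
    exact ⟨q, rfl⟩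
  let φ : MvPolynomial (Fin m × ℕ) U →ₐ[U] A := MvPolynomial.aeval fun p => ⟨_, hmem p⟩
  have hφ : ∀ f w, (φ f : {w | τ w ∈ W} → U) w = diffEval (τ w) f := fun f w => by
    have h1 : A.val (φ f) = MvPolynomial.aeval
        (fun (p : Fin m × ℕ) (w : {w | τ w ∈ W}) => iterDeriv p.2 (τ w p.1)) f :=
      MvPolynomial.comp_aeval_apply _ A.val f
    exact (congrFun h1 w).trans (MvPolynomial.aeval_pi_apply _ _ _)
  -- Every point of `W` has a parameter, so the coordinate ring of `W` embeds into the functions on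
  -- its parameter set.
  have hker : ∀ f, f ∈ vanishingDiffIdeal W ↔ φ f = 0 := fun f => by
    constructor
    · exact fun hf => Subtype.ext (funext fun w => (hφ f w).trans (hf _ w.2))
    · intro hf a ha
      obtain ⟨w, rfl⟩ := hW ha
      rw [← hφ f ⟨w, ha⟩, hf]
      rfl
  refine trdeg_le_of_injective
    (Ideal.Quotient.liftₐ (vanishingDiffIdeal W) φ fun f hf => (hker f).1 hf) ?_
  exact RingHom.lift_injective_of_ker_le_ideal _ (fun f hf => (hker f).1 hf)
    fun f hf => (hker f).2 hf

end FiniteRank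

end

/-! ### The main theorem -/

theorem theorem3 {U : Type*} [Field U] [CharZero U] [Differential U]
    (hU : IsDifferentiallyClosed U) {h m : ℕ} (hh : 1 < h) (hm : 1 < m)
    (β : Fin (h + 1) → Fin m → U)
    (hβ : DiffIndependent (fun p : Fin (h + 1) × Fin m => β p.1 p.2)) :
    -- a definable bijection with the affine line, by linear substitutions over `ℚ⟨β⟩`
    (∃ σ : (Fin m → U) → (Fin m → U),
      IsLinearSubstitution (diffFieldGen (fun p : Fin (h + 1) × Fin m => β p.1 p.2)) σ ∧
      Set.BijOn σ (solutionSet hm β) {w | ∀ j : Fin m, j ≠ ⟨0, by omega⟩ → w j = 0} ∧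
      Set.BijOn (fun z => σ z ⟨0, by omega⟩) (solutionSet hm β) Set.univ) ∧
    -- no proper differential subvariety of infinite rank
    (∀ W : Set (Fin m → U), IsKolchinClosed W → W ⊂ solutionSet hm β → ¬ HasInfiniteRank W) ∧
    -- no proper definable subspace (even additive subgroup) of infinite rank
    (∀ H : AddSubgroup (Fin m → U), IsKolchinConstructible (H : Set (Fin m → U)) →
      (H : Set (Fin m → U)) ⊂ solutionSet hm β → ¬ HasInfiniteRank (H : Set (Fin m → U))) := by
  obtain ⟨σ, hσ, hS⟩ := exists_linearSubstitution hU hh hm hβ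
  obtain ⟨ρ, hρ, hρσ, hσρ⟩ := hσ.exists_inverse
  set o : Fin m := ⟨0, by omega⟩
  -- The inverse substitution on the first axis: an additive parametrization of `S`.
  set τ : U → Fin m → U := fun w => ρ (Pi.single o w)
  have hστ : ∀ w, σ (τ w) = Pi.single o w := fun w => hσρ _
  have hτS : ∀ w, τ w ∈ solutionSet hm β := fun w => (hS _).2 fun j hj => by
    rw [hστ, Pi.single_eq_of_ne hj]
  have hSτ : ∀ z ∈ solutionSet hm β, τ (σ z o) = z := fun z hz => by
    have : Pi.single o (σ z o) = σ z := funext fun j => by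
      by_cases hj : j = o
      · rw [hj, Pi.single_eq_same]
      · rw [Pi.single_eq_of_ne hj, (hS z).1 hz j hj]
    change ρ (Pi.single o (σ z o)) = z
    rw [this, hρσ]
  have hτ : ∀ j, IsDiffPolyFun fun w => τ w j := hρ.isDiffPolyFun fun j => by
    by_cases hj : j = o
    · subst hj
      simp only [Pi.single_eq_same]
      exact .id
    · simp only [Pi.single_eq_of_ne hj]
      exact .zero
  have hadd : ∀ u v, τ (u + v) = τ u + τ v := fun u v => by
    change ρ _ = ρ _ + ρ _
    rw [Pi.single_add, hρ.map_add]
  refine ⟨⟨σ, hσ, ⟨fun z hz => (hS z).1 hz, hρσ.injective.injOn, fun w hw => ?_⟩,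
    fun _ _ => trivial, fun z hz z' hz' e => ?_, fun w _ => ⟨τ w, hτS w, ?_⟩⟩, ?_, ?_⟩
  · exact ⟨ρ w, (hS _).2 fun j hj => by rw [hσρ]; exact hw j hj, hσρ w⟩
  · rw [← hSτ z hz, ← hSτ z' hz']
    exact congrArg τ e
  · change σ (τ w) o = w
    rw [hστ, Pi.single_eq_same]
  · rintro W ⟨T, rfl⟩ hWS
    obtain ⟨z, hz, hzW⟩ := Set.exists_of_ssubset hWS
    obtain ⟨f, hfT, hf⟩ : ∃ f ∈ T, diffEval z f ≠ 0 := by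
      by_contra! hc
      exact hzW hc
    obtain ⟨q, hq⟩ := IsDiffPolyFun.diffEval_comp hτ f
    -- The pullback `q` of an equation of `W` that fails at some `z` in `S` is nonzero, as it does
    -- not vanish at the parameter of `z`.
    refine not_hasInfiniteRank hτ (fun z hz => ⟨_, hSτ z (hWS.1 hz)⟩) (g := q) ?_
      fun w hw => (hq w).symm.trans (hw f hfT)
    rintro rfl
    have : diffEval (τ (σ z o)) f = _ := hq (σ z o)
    rw [hSτ z hz, map_zero] at this
    exact hf this
  · intro H hH hHS
    have hHτ : (H : Set (Fin m → U)) ⊆ Set.range τ := fun z hz => ⟨_, hSτ z (hHS.1 hz)⟩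
    rcases hH.exists_ne_zero hτ with ⟨g, hg, hgH⟩ | ⟨g, hg, hgH⟩
    · exact not_hasInfiniteRank hτ hHτ hg hgH
    · refine (hHS.2 fun z hz => ?_).elim
      rw [← hSτ z hz]
      exact H.mem_of_forall_notMem_eval_eq_zero hU hadd hg hgH _
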